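/- **Game.** Let $(\mathcal G,v_0)$ be a multiplayer reachability game: a finite set $P$ of players, a finite directed graph $(V,E)$ without deadlocks, a partition $(V_i)_{i\in P}$ of $V$ (the vertices owned by each player), target sets $F_i\subseteq V$, weights $w:E\to\mathbb N$ and an initial vertex $v_0$. Write $\mathrm{Succ}(v)$ for the set of successors of $v$. Plays are infinite paths and histories are non-empty finite paths; $\mathrm{Hist}(v)$ is the set of histories starting in $v$, and $\mathrm{Hist}_i(v)$ the subset of those that end in $V_i$. A play has gain $\mathrm{gain}_i(\rho)=1$ if it visits $F_i$ and $0$ otherwise. $\mathrm{Visit}(h)$ is the set of players $i$ such that some vertex of $h$ (the first one included) lies in $F_i$. **Equilibria.** A strategy of player $i$ maps each $hv\in\mathrm{Hist}_i(v_0)$ to an element of $\mathrm{Succ}(v)$; $\langle\sigma\rangle_v$ is the outcome of a strategy profile $\sigma$ from $v$, and $\sigma_{\restriction h}(h')=\sigma(hh')$. The profile $\sigma$ is an SPE if for every $hv\in\mathrm{Hist}(v_0)$ the profile $\sigma_{\restriction h}$ is a Nash equilibrium in the game from $v$ with gains $\rho\mapsto \mathrm{gain}_i(h\rho)$. A multi-strategy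 of player $i$ maps each $hv\in \mathrm{Hist}_i(v_0)$ to a non-empty subset of $\mathrm{Succ}(v)$. A strategy profile $\sigma$ is consistent with a multi-strategy profile $\Theta$, written $\sigma\lesssim\Theta$, if it always chooses inside $\Theta$; $\Theta$ is a permissive SPE if every $\sigma\lesssim\Theta$ is an SPE. $\mathrm{Out}(\Theta,v)$ is the set of the plays $\langle\sigma\rangle_v$ with $\sigma\lesssim\Theta$, and $\mathrm{Hist}(\Theta,v)$ the set of their non-empty finite prefixes. $\Theta$ is strongly (weakly) winning w.r.t. $W\subseteq P$ if for all (for some) $\sigma\lesssim\Theta$, $\mathrm{gain}_i(\langle\sigma\rangle_{v_0})=1$ for all $i\in W$. **Penalties.** For a play $\rho=\rho_0\rho_1\cdots$, $\mathrm{pen}_i^\Theta(\rho)\in\mathbb N\cup\{\infty\}$ is the sum, over all $k$ with $\rho_k\in V_i$, of $\sum_{u\in \mathrm{Succ}(\rho_k)\setminus\Theta_i(\rho_0\cdots\rho_k)}w(\rho_k,u)$. The main penalty is $\mathrm{MP}_i(\Theta)=\sup_{\rho\in\mathrm{Out}(\Theta,v_0)}\mathrm{pen}^\Theta_i(\rho)$,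 and the retaliation penalty $\mathrm{RP}_i(\Theta)$ is the supremum of $\mathrm{pen}_i^{\Theta_{\restriction h}}(\rho)$ over all $hv\in\mathrm{Hist}_i(v_0)\setminus\mathrm{Hist}(\Theta,v_0)$ and $\rho\in\mathrm{Out}(\Theta_{\restriction h},v)$ (with $\sup\emptyset=0$). **Trees.** A tree rooted at $v$ is a set $T\subseteq\mathrm{Hist}(v)$ containing $v$ and closed under non-empty prefixes; a leaf is a node without children. $T^\infty$ is the set of plays from $v$ all of whose non-empty finite prefixes are in $T$. For $hu\in T$, $T_{\restriction hu}=\{h'\in\mathrm{Hist}(u): hh'\in T\}$. $\mathrm{pen}_i(T)$ is the supremum over $\rho\in T^\infty$ of the sum, over all $k$ with $\rho_k\in V_i$, of $\sum w(\rho_k,u)$ over the $u\in\mathrm{Succ}(\rho_k)$ with $\rho_0\cdots\rho_ku\notin T$. $T$ is $D$-resistant to internal deviations ($D\subseteq P$) if for all $i\in D$ and all $hv\in T$ with $v\in V_i$ and at least two children in $T$, $\mathrm{gain}_i(h\rho)=\mathrm{gain}_i(h\rho')$ for all $\rho,\rho'\in (T_{\restriction hv})^\infty$. **Forests.** Let $I_0=\{i: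 v_0\in F_i\}$ and let $\mathcal I$ consist of $(0,v_0,I_0)$, where $0\notin P$, and of all $(i,v,I)$ such that there is $hv'\in\mathrm{Hist}_i(v_0)$ with $v\in\mathrm{Succ}(v')$ and $I=\mathrm{Visit}(hv'v)$. A forest $\mathcal F$ assigns to each $(i,v,I)\in\mathcal I$ a tree $T_{i,v,I}$ without leaves, rooted at $v$. $T_{i,v,I}$ is resistant to constrained external deviations if for all $hu\in T_{i,v,I}$ and $j\in P$ with $u\in V_j$ and $j\notin I\cup\mathrm{Visit}(hu)$, and all $u'\in\mathrm{Succ}(u)$ with $huu'\notin T_{i,v,I}$: if $\mathrm{gain}_j(\rho')=1$ for some $\rho'\in T_{j,u',I'}^\infty$, where $I'=I\cup\mathrm{Visit}(huu')$, then $\mathrm{gain}_j(\rho)=1$ for all $\rho\in(T_{i,v,I\restriction hu})^\infty$. $\mathcal F$ is good if every $T_{i,v,I}$ is $(P\setminus I)$-resistant to internal deviations and resistant to constrained external deviations. Put $\mathrm{MP}_i(\mathcal F)=\mathrm{pen}_i(T_{0,v_0,I_0})$ and $\mathrm{RP}_i(\mathcal F)=\sup \mathrm{pen}_i(T_{j,v,I})$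 over all $(j,v,I)$, $j\in P$, such that there is $hv\in\mathrm{Hist}(v_0)\setminus T_{0,v_0,I_0}$ with the last vertex of $h$ in $V_j$ and $I=\mathrm{Visit}(hv)$ (with $\sup\emptyset=0$). **Theorem.** Let $m,r\in(\mathbb N\cup\{\infty\})^P$, let $T^*$ be a tree rooted at $v_0$ and let $W\subseteq P$. The following are equivalent: 1. there is a permissive SPE $\Theta$ in $(\mathcal G,v_0)$ such that (a) $\mathrm{Hist}(\Theta,v_0)=T^*$; (b) $\Theta$ is strongly winning w.r.t. $W$; (c) $\mathrm{MP}_i(\Theta)\le m_i$ and $\mathrm{RP}_i(\Theta)\le r_i$ for all $i\in P$; 2. there is a good forest $\mathcal F$ in $(\mathcal G,v_0)$ such that (a) $T_{0,v_0,I_0}=T^*$; (b) $\mathrm{gain}_i(\rho)=1$ for all $\rho\in T_{0,v_0,I_0}^\infty$ and all $i\in W$; (c) $\mathrm{MP}_i(\mathcal F)\le m_i$ and $\mathrm{RP}_i(\mathcal F)\le r_i$ for all $i\in P$. The equivalence also holds with 1(b) replaced by "$\Theta$ is weakly winning w.r.t. $W$" and 2(b) by "there is $\rho\in T_{0,v_0,I_0}^\infty$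 with $\mathrm{gain}_i(\rho)=1$ for all $i\in W$". -/

import Mathlib

/-- A multiplayer reachability game with player set `P` on the finite directed graph `(V, Edge)`
without deadlocks, without its initial vertex (which is a separate argument everywhere).
The partition `(V_i)` is given by `owner`: `V_i = {v | owner v = i}`.  The values of `weight` on
pairs that are not edges are never used. -/
structure ReachGame (P V : Type*) where
  /-- the edge relation -/
  Edge : V → V → Prop
  /-- there are no deadlocks -/
  no_deadlock : ∀ v, ∃ v', Edge v v'
  /-- the player who owns a vertex -/
  owner : V → P
  /-- the target set of each player -/
  target : P → Set V
  /-- the penalty for not allowing an edge -/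
  weight : V → V → ℕ

namespace ReachGame

variable {P V : Type*}

/-! ### Plays and histories -/

/-- Plays beginning in `v`. -/
def Plays (G : ReachGame P V) (v : V) : Set (ℕ → V) :=
  {ρ | ρ 0 = v ∧ ∀ k, G.Edge (ρ k) (ρ (k + 1))}

/-- Histories beginning in `v`: non-empty finite paths, written from left to right. -/
def Hist (G : ReachGame P V) (v : V) : Set (List V) :=
  {h | h.head? = some v ∧ h.IsChain G.Edge}

/-- Histories beginning in `v` whose last vertex is owned by player `i`. -/
def HistOf (G : ReachGame P V) (i : P) (v : V) : Set (List V) :=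
  {l | l ∈ G.Hist v ∧ ∃ h u, l = h ++ [u] ∧ G.owner u = i}

/-- The non-empty prefix `ρ₀ ⋯ ρₖ` of an infinite sequence. -/
def pre (ρ : ℕ → V) (k : ℕ) : List V := (List.range (k + 1)).map ρ

/-- The concatenation `hρ` of a finite and an infinite sequence. -/
def cat (h : List V) (ρ : ℕ → V) : ℕ → V := fun n => h.getD n (ρ (n - h.length))

open Classical in
/-- The gain of player `i`: `1` if the target set is reached at some position, else `0`. -/
noncomputable def gain (G : ReachGame P V) (i : P) (ρ : ℕ → V) : ℕ :=
  if ∃ k, ρ k ∈ G.target i then 1 else 0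

/-- The set of players who visit their target set along `h`, first vertex included. -/
def visit (G : ReachGame P V) (h : List V) : Set P := {i | ∃ u ∈ h, u ∈ G.target i}

/-! ### Strategies and subgame perfect equilibria

A strategy of player `i` in the game from `v` is a function on all lists of vertices of which only
the values on `HistOf i v` matter. -/

/-- `s` is a strategy of player `i` in the game from `v`. -/
def IsStrategy (G : ReachGame P V) (v : V) (i : P) (s : List V → V) : Prop :=
  ∀ h u, h ++ [u] ∈ G.HistOf i v → G.Edge u (s (h ++ [u]))

/-- `σ` is a strategy profile in the game from `v`. -/
def IsProfile (G : ReachGame P V) (v : V) (σ : P → List V → V) : Prop :=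
  ∀ i, G.IsStrategy v i (σ i)

/-- The pair `(ρ₀ ⋯ ρₖ₋₁, ρₖ)` for the outcome `ρ` of `σ` from `v`. -/
def outcomeAux (G : ReachGame P V) (σ : P → List V → V) (v : V) : ℕ → List V × V
  | 0 => ([], v)
  | k + 1 =>
    let p := outcomeAux G σ v k
    (p.1 ++ [p.2], σ (G.owner p.2) (p.1 ++ [p.2]))

/-- The outcome of the profile `σ` from `v`: at each vertex, its owner plays by his strategy. -/
def outcome (G : ReachGame P V) (σ : P → List V → V) (v : V) : ℕ → V :=
  fun k => (G.outcomeAux σ v k).2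

/-- The restriction of a profile of strategies or of multi-strategies after `h`. -/
def restrict {α : Type*} (σ : P → List V → α) (h : List V) : P → List V → α :=
  fun i h' => σ i (h ++ h')

open Classical in
/-- `σ` is a Nash equilibrium in the subgame after `h` that starts in `v`; the gain of a play `ρ`
of this subgame is the gain of `hρ`. -/
def IsNE (G : ReachGame P V) (h : List V) (v : V) (σ : P → List V → V) : Prop :=
  ∀ i s, G.IsStrategy v i s →
    G.gain i (cat h (G.outcome (Function.update σ i s) v)) ≤ G.gain i (cat h (G.outcome σ v))

/-- `σ` is a subgame perfect equilibrium in the game from `v₀`. -/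
def IsSPE (G : ReachGame P V) (v₀ : V) (σ : P → List V → V) : Prop :=
  ∀ h v, h ++ [v] ∈ G.Hist v₀ → G.IsNE h v (restrict σ h)

/-! ### Multi-strategies -/

/-- `Θ` is a multi-strategy profile in the game from `v`. -/
def IsMulti (G : ReachGame P V) (v : V) (Θ : P → List V → Set V) : Prop :=
  ∀ i h u, h ++ [u] ∈ G.HistOf i v →
    (Θ i (h ++ [u])).Nonempty ∧ ∀ u' ∈ Θ i (h ++ [u]), G.Edge u u'

/-- The strategy profile `σ` in the game from `v` is consistent with `Θ`. -/
def Consistent (G : ReachGame P V) (v : V) (σ : P → List V → V) (Θ : P → List V → Set V) : Prop :=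
  G.IsProfile v σ ∧ ∀ i, ∀ h ∈ G.HistOf i v, σ i h ∈ Θ i h

/-- The outcomes of `Θ` from `v`. -/
def multiOutcome (G : ReachGame P V) (Θ : P → List V → Set V) (v : V) : Set (ℕ → V) :=
  {ρ | ∃ σ, G.Consistent v σ Θ ∧ G.outcome σ v = ρ}

/-- The histories consistent with `Θ` from `v`: non-empty finite prefixes of its outcomes. -/
def multiHist (G : ReachGame P V) (Θ : P → List V → Set V) (v : V) : Set (List V) :=
  {h | ∃ ρ ∈ G.multiOutcome Θ v, ∃ k, h = pre ρ k}

/-- `Θ` is a permissive subgame perfect equilibrium in the game from `v₀`. -/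
def IsPermissiveSPE (G : ReachGame P V) (v₀ : V) (Θ : P → List V → Set V) : Prop :=
  G.IsMulti v₀ Θ ∧ ∀ σ, G.Consistent v₀ σ Θ → G.IsSPE v₀ σ

/-- Every consistent strategy profile wins for all players in `W`. -/
def StronglyWinning (G : ReachGame P V) (v₀ : V) (Θ : P → List V → Set V) (W : Set P) : Prop :=
  ∀ σ, G.Consistent v₀ σ Θ → ∀ i ∈ W, G.gain i (G.outcome σ v₀) = 1

/-- Some consistent strategy profile wins for all players in `W`. -/
def WeaklyWinning (G : ReachGame P V) (v₀ : V) (Θ : P → List V → Set V) (W : Set P) : Prop :=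
  ∃ σ, G.Consistent v₀ σ Θ ∧ ∀ i ∈ W, G.gain i (G.outcome σ v₀) = 1

/-! ### Penalties of multi-strategies -/

open Classical in
/-- The total weight of the edges from `v` to successors that are not in `A`. -/
noncomputable def missedWeight [Fintype V] (G : ReachGame P V) (v : V) (A : Set V) : ℕ :=
  ∑ u : V, if G.Edge v u ∧ u ∉ A then G.weight v u else 0

open Classical in
/-- The penalty of player `i` with respect to `Θ` in the first `k` vertices of `ρ`. -/
noncomputable def penalPre [Fintype V] (G : ReachGame P V) (Θ : P → List V → Set V) (i : P)
    (ρ : ℕ → V) : ℕ → ℕ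
  | 0 => 0
  | k + 1 => penalPre G Θ i ρ k +
      if G.owner (ρ k) = i then G.missedWeight (ρ k) (Θ i (pre ρ k)) else 0

/-- The penalty of player `i` with respect to `Θ` in the play `ρ`: the limit (supremum) of a
non-decreasing sequence of natural numbers. -/
noncomputable def penal [Fintype V] (G : ReachGame P V) (Θ : P → List V → Set V) (i : P)
    (ρ : ℕ → V) : ℕ∞ :=
  ⨆ k, (G.penalPre Θ i ρ k : ℕ∞)

/-- The main penalty of player `i`. -/
noncomputable def mainPenalty [Fintype V] (G : ReachGame P V) (Θ : P → List V → Set V) (v₀ : V)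
    (i : P) : ℕ∞ :=
  ⨆ ρ ∈ G.multiOutcome Θ v₀, G.penal Θ i ρ

/-- The retaliation penalty of player `i`: the supremum, over the histories `hv` with `v` owned by
`i` that are not consistent with `Θ`, of the penalties in the outcomes of `Θ` in the subgame after
`h` that starts in `v`.  It is `0` if there is no such history. -/
noncomputable def retaliationPenalty [Fintype V] (G : ReachGame P V) (Θ : P → List V → Set V)
    (v₀ : V) (i : P) : ℕ∞ :=
  ⨆ (h : List V) (v : V) (_ : h ++ [v] ∈ G.HistOf i v₀ ∧ h ++ [v] ∉ G.multiHist Θ v₀),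
    ⨆ ρ ∈ G.multiOutcome (restrict Θ h) v, G.penal (restrict Θ h) i ρ

/-! ### Trees -/

/-- `T` is a tree over `G` rooted at `v`. -/
def IsTree (G : ReachGame P V) (v : V) (T : Set (List V)) : Prop :=
  T ⊆ G.Hist v ∧ [v] ∈ T ∧ ∀ h u, h ≠ [] → h ++ [u] ∈ T → h ∈ T

/-- `T` has no leaves: each node has a child. -/
def NoLeaves (T : Set (List V)) : Prop := ∀ h ∈ T, ∃ u, h ++ [u] ∈ T

/-- The subtree of `T` at the node `hu`. -/
def subtree (G : ReachGame P V) (T : Set (List V)) (h : List V) (u : V) : Set (List V) :=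
  {h' | h' ∈ G.Hist u ∧ h ++ h' ∈ T}

/-- The plays represented by the infinite branches of a tree `T` rooted at `v`. -/
def branches (G : ReachGame P V) (v : V) (T : Set (List V)) : Set (ℕ → V) :=
  {ρ | ρ ∈ G.Plays v ∧ ∀ k, pre ρ k ∈ T}

open Classical in
/-- The penalty of player `i` at the node `ρ₀ ⋯ ρₖ` of `T`: the successors of `ρ₀ ⋯ ρⱼ` (`j < k`)
that are blocked in `T` count if `i` owns `ρⱼ`. -/
noncomputable def treePenalPre [Fintype V] (G : ReachGame P V) (T : Set (List V)) (i : P)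
    (ρ : ℕ → V) : ℕ → ℕ
  | 0 => 0
  | k + 1 => treePenalPre G T i ρ k +
      if G.owner (ρ k) = i then G.missedWeight (ρ k) {u | pre ρ k ++ [u] ∈ T} else 0

/-- The penalty of player `i` in a tree `T` rooted at `v`. -/
noncomputable def treePenalty [Fintype V] (G : ReachGame P V) (v : V) (T : Set (List V)) (i : P) :
    ℕ∞ :=
  ⨆ ρ ∈ G.branches v T, ⨆ k, (G.treePenalPre T i ρ k : ℕ∞)

/-- `T` is `D`-resistant to internal deviations. -/
def ResistsInternal (G : ReachGame P V) (D : Set P) (T : Set (List V)) : Prop :=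
  ∀ i ∈ D, ∀ h v, h ++ [v] ∈ T → G.owner v = i →
    {v' | h ++ [v] ++ [v'] ∈ T}.Nontrivial →
    ∀ ρ ∈ G.branches v (G.subtree T h v), ∀ ρ' ∈ G.branches v (G.subtree T h v),
      G.gain i (cat h ρ) = G.gain i (cat h ρ')

/-! ### Forests -/

/-- An index `(i, v, I)` of a tree in a forest; `none` in the first component marks the
main tree. -/
abbrev Index (P V : Type*) := Option P × V × Set P

/-- The index of the main tree. -/
def rootIndex (G : ReachGame P V) (v₀ : V) : Index P V := (none, v₀, {i | v₀ ∈ G.target i})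

/-- The set of indices of the trees of a forest. -/
def Indices (G : ReachGame P V) (v₀ : V) : Set (Index P V) :=
  {G.rootIndex v₀} ∪
    {x | ∃ i h v' v, h ++ [v'] ∈ G.HistOf i v₀ ∧ G.Edge v' v ∧
      x = (some i, v, G.visit (h ++ [v'] ++ [v]))}

/-- `F` is a forest in the game from `v₀`.  Only its values on `Indices` matter. -/
def IsForest (G : ReachGame P V) (v₀ : V) (F : Index P V → Set (List V)) : Prop :=
  ∀ x ∈ G.Indices v₀, G.IsTree x.2.1 (F x) ∧ NoLeaves (F x)

/-- The tree of `F` with index `x = (i, v, I)` is resistant to constrained external deviations. -/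
def ResistsConstrainedExternal (G : ReachGame P V) (F : Index P V → Set (List V))
    (x : Index P V) : Prop :=
  ∀ h u j, h ++ [u] ∈ F x → G.owner u = j → j ∉ x.2.2 ∪ G.visit (h ++ [u]) →
    ∀ u', G.Edge u u' → h ++ [u] ++ [u'] ∉ F x →
      (∃ ρ' ∈ G.branches u' (F (some j, u', x.2.2 ∪ G.visit (h ++ [u] ++ [u']))),
        G.gain j ρ' = 1) →
      ∀ ρ ∈ G.branches u (G.subtree (F x) h u), G.gain j ρ = 1

/-- `F` is a good forest in the game from `v₀`. -/
def IsGoodForest (G : ReachGame P V) (v₀ : V) (F : Index P V → Set (List V)) : Prop :=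
  G.IsForest v₀ F ∧
    ∀ x ∈ G.Indices v₀, G.ResistsInternal (x.2.2)ᶜ (F x) ∧ G.ResistsConstrainedExternal F x

/-- The main penalty of a forest for player `i`. -/
noncomputable def forestMainPenalty [Fintype V] (G : ReachGame P V) (v₀ : V)
    (F : Index P V → Set (List V)) (i : P) : ℕ∞ :=
  G.treePenalty v₀ (F (G.rootIndex v₀)) i

/-- The indices of the trees that are deviations from the main tree. -/
def Out (G : ReachGame P V) (v₀ : V) (F : Index P V → Set (List V)) : Set (Index P V) :=
  {x | ∃ j h v' v, h ++ [v'] ++ [v] ∈ G.Hist v₀ ∧ h ++ [v'] ++ [v] ∉ F (G.rootIndex v₀) ∧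
    G.owner v' = j ∧ x = (some j, v, G.visit (h ++ [v'] ++ [v]))}

/-- The retaliation penalty of a forest for player `i`; it is `0` if `Out` is empty. -/
noncomputable def forestRetaliationPenalty [Fintype V] (G : ReachGame P V) (v₀ : V)
    (F : Index P V → Set (List V)) (i : P) : ℕ∞ :=
  ⨆ x ∈ G.Out v₀ F, G.treePenalty x.2.1 (F x) i

end ReachGame

namespace ReachGame

variable {P V : Type*} {G : ReachGame P V}

/-! ### Lists, plays and gains -/

/-! Both sides reduce to one local condition, `NoOneShotDeviation`. Suppose that the owner of `v`
has not yet visited his target set and wins in some outcome after moving to `v₁`; then he wins in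
every outcome from `v` that starts with another move.

This condition characterises permissive SPEs. It is necessary because the two outcomes use disjoint
sets of histories, so a single consistent profile can follow both, and moving to `v₁` once must not
pay off. It is sufficient because a profitable deviation reaches its target after finitely many
steps, so induction on that number removes the deviating moves one at a time.

From `Θ` to a forest: each index gets a representative history, and its tree is the set of histories
of `Θ` after it. Many histories share an index `(j, v, I)`. The representative is chosen outside
`Hist(Θ, v₀)` if possible, and then, if possible, such that `j` wins in no outcome. If `j` can win
in the chosen tree, he can then win after every deviation with this index, so the local condition
applies at the actual history. Choosing deviations also keeps the penalties of these trees below the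
retaliation penalty.

From a forest to `Θ`: each history has a position in the forest, which follows the current tree and
jumps to the root of another tree when it leaves it; `Θ` allows exactly the children of the current
node. The local condition for an allowed `v₁` is internal resistance, and for a blocked `v₁`
external resistance.

In both directions the main tree is `Hist(Θ, v₀)`. Its branches are the outcomes of `Θ`
(`branches_multiHist`), so the winning conditions and main penalties agree, and only the retaliation
penalties need estimates. -/

theorem pre_zero (ρ : ℕ → V) : pre ρ 0 = [ρ 0] := rfl

theorem pre_succ (ρ : ℕ → V) (k : ℕ) : pre ρ (k + 1) = pre ρ k ++ [ρ (k + 1)] := by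
  simp [pre, List.range_succ]

theorem length_pre (ρ : ℕ → V) (k : ℕ) : (pre ρ k).length = k + 1 := by simp [pre]

theorem exists_pre_eq (ρ : ℕ → V) (k : ℕ) : ∃ h, pre ρ k = h ++ [ρ k] := by
  cases k with
  | zero => exact ⟨[], rfl⟩
  | succ k => exact ⟨_, pre_succ ρ k⟩

theorem pre_congr {ρ ρ' : ℕ → V} {k : ℕ} (H : ∀ n ≤ k, ρ n = ρ' n) : pre ρ k = pre ρ' k := by
  simp only [pre, List.map_inj_left, List.mem_range]
  exact fun n hn => H n (by omega)

theorem pre_injective_of_eq {ρ ρ' : ℕ → V} {k n : ℕ} (H : pre ρ k = pre ρ' k) (hn : n ≤ k) :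
    ρ n = ρ' n := by
  simp only [pre, List.map_inj_left, List.mem_range] at H
  exact H n (by omega)

theorem cat_add (h : List V) (ρ : ℕ → V) (k : ℕ) : cat h ρ (h.length + k) = ρ k := by
  simp [cat]

theorem cat_of_lt {h : List V} (ρ : ℕ → V) {k : ℕ} (hk : k < h.length) : cat h ρ k = h[k] := by
  simp [cat, hk]

theorem cat_singleton_zero (v : V) (ρ : ℕ → V) : cat [v] ρ 0 = v := rfl

theorem cat_singleton_succ (v : V) (ρ : ℕ → V) (k : ℕ) : cat [v] ρ (k + 1) = ρ k := by
  simp [cat]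

theorem pre_cat (h : List V) (ρ : ℕ → V) (k : ℕ) :
    pre (cat h ρ) (h.length + k) = h ++ pre ρ k := by
  apply List.ext_getElem
  · simp [length_pre]; omega
  · intro n h1 h2
    by_cases hn : n < h.length
    · simp [pre, hn, cat]
    · simp [pre, List.getElem_append, hn, cat]

theorem pre_cat_singleton (v : V) (ρ : ℕ → V) (k : ℕ) :
    pre (cat [v] ρ) (k + 1) = v :: pre ρ k := by
  rw [add_comm]; exact pre_cat [v] ρ k

theorem cat_tail (ρ : ℕ → V) : cat [ρ 0] (fun k => ρ (k + 1)) = ρ := by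
  funext n
  cases n with
  | zero => rfl
  | succ n => rw [cat_singleton_succ]

theorem gain_eq_one {i : P} {ρ : ℕ → V} : G.gain i ρ = 1 ↔ ∃ k, ρ k ∈ G.target i := by
  simp [gain]

theorem gain_le_one (i : P) (ρ : ℕ → V) : G.gain i ρ ≤ 1 := by
  unfold gain; split <;> simp

theorem gain_cat {i : P} {h : List V} {ρ : ℕ → V} :
    G.gain i (cat h ρ) = 1 ↔ i ∈ G.visit h ∨ G.gain i ρ = 1 := by
  simp only [gain_eq_one, visit, Set.mem_ofPred_eq]
  constructor
  · rintro ⟨k, hk⟩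
    by_cases hl : k < h.length
    · rw [cat_of_lt ρ hl] at hk
      exact Or.inl ⟨_, List.getElem_mem hl, hk⟩
    · obtain ⟨n, rfl⟩ := Nat.exists_eq_add_of_le (not_lt.1 hl)
      rw [cat_add] at hk
      exact Or.inr ⟨n, hk⟩
  · rintro (⟨u, hu, ht⟩ | ⟨k, hk⟩)
    · obtain ⟨n, hn, rfl⟩ := List.getElem_of_mem hu
      exact ⟨n, by rwa [cat_of_lt ρ hn]⟩
    · exact ⟨h.length + k, by rwa [cat_add]⟩

theorem visit_append (h h' : List V) : G.visit (h ++ h') = G.visit h ∪ G.visit h' := by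
  ext i
  simp only [visit, List.mem_append, Set.mem_ofPred_eq, Set.mem_union]
  constructor
  · rintro ⟨u, hu | hu, ht⟩
    exacts [Or.inl ⟨u, hu, ht⟩, Or.inr ⟨u, hu, ht⟩]
  · rintro (⟨u, hu, ht⟩ | ⟨u, hu, ht⟩)
    exacts [⟨u, Or.inl hu, ht⟩, ⟨u, Or.inr hu, ht⟩]

theorem singleton_mem_hist {u v : V} : [u] ∈ G.Hist v ↔ u = v := by
  simp [Hist]

theorem snoc_mem_hist {h : List V} {u u' v : V} :
    h ++ [u] ++ [u'] ∈ G.Hist v ↔ h ++ [u] ∈ G.Hist v ∧ G.Edge u u' := by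
  have hd : (h ++ [u] ++ [u']).head? = (h ++ [u]).head? := by cases h <;> simp
  have hc : (h ++ [u] ++ [u']).IsChain G.Edge ↔ (h ++ [u]).IsChain G.Edge ∧ G.Edge u u' := by
    rw [List.isChain_append]
    simp
  simp only [Hist, Set.mem_ofPred_eq, hd, hc, and_assoc]

/-- Induction over histories, written as `h ++ [u]`. -/
theorem hist_induction {v : V} {p : List V → V → Prop} (base : p [] v)
    (step : ∀ h u u', h ++ [u] ∈ G.Hist v → G.Edge u u' → p h u → p (h ++ [u]) u')
    (h : List V) (u : V) (hu : h ++ [u] ∈ G.Hist v) : p h u := by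
  induction h using List.reverseRecOn generalizing u with
  | nil => rw [singleton_mem_hist.1 hu]; exact base
  | append_singleton h a ih =>
    obtain ⟨h1, h2⟩ := snoc_mem_hist.1 hu
    exact step h a u h1 h2 (ih a h1)

theorem exists_snoc_of_mem_hist {h : List V} {v : V} (hh : h ∈ G.Hist v) :
    ∃ h' u, h = h' ++ [u] := by
  rcases List.eq_nil_or_concat h with rfl | ⟨h', u, rfl⟩
  · simp [Hist] at hh
  · exact ⟨h', u, by simp⟩

theorem append_mem_hist {g h : List V} {v v₀ : V} (hg : g ++ [v] ∈ G.Hist v₀)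
    (hh : h ∈ G.Hist v) : g ++ h ∈ G.Hist v₀ := by
  obtain ⟨h, u, rfl⟩ := exists_snoc_of_mem_hist hh
  refine hist_induction (p := fun h u => g ++ (h ++ [u]) ∈ G.Hist v₀) (by simpa using hg) ?_ h u hh
  intro h u u' _ he ih
  rw [← List.append_assoc] at ih
  have := snoc_mem_hist.2 ⟨ih, he⟩
  simpa using this

theorem snoc_mem_histOf {h : List V} {u v : V} {i : P} :
    h ++ [u] ∈ G.HistOf i v ↔ h ++ [u] ∈ G.Hist v ∧ G.owner u = i := by
  constructor
  · rintro ⟨h1, h', u', he, ho⟩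
    obtain ⟨rfl, h2⟩ := List.append_inj' he rfl
    simp only [List.cons.injEq, and_true] at h2
    exact ⟨h1, h2 ▸ ho⟩
  · rintro ⟨h1, h2⟩
    exact ⟨h1, h, u, rfl, h2⟩

theorem pre_mem_hist {ρ : ℕ → V} {v : V} (hρ : ρ ∈ G.Plays v) (k : ℕ) : pre ρ k ∈ G.Hist v := by
  induction k with
  | zero => rw [pre_zero, hρ.1]; exact singleton_mem_hist.2 rfl
  | succ k ih =>
    rw [pre_succ]
    obtain ⟨h, hh⟩ := exists_pre_eq ρ k
    rw [hh] at ih ⊢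
    exact snoc_mem_hist.2 ⟨ih, hρ.2 k⟩

/-! ### Outcomes -/

theorem outcomeAux_eq {σ : P → List V → V} {v : V} (k : ℕ) :
    (G.outcomeAux σ v k).1 ++ [(G.outcomeAux σ v k).2] = pre (G.outcome σ v) k := by
  induction k with
  | zero => rfl
  | succ k ih => rw [pre_succ, ← ih]; rfl

theorem outcome_succ (σ : P → List V → V) (v : V) (k : ℕ) :
    G.outcome σ v (k + 1) =
      σ (G.owner (G.outcome σ v k)) (pre (G.outcome σ v) k) := by
  rw [← outcomeAux_eq]; rfl

theorem outcome_eq_iff {σ : P → List V → V} {v : V} {ρ : ℕ → V} :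
    G.outcome σ v = ρ ↔ ρ 0 = v ∧ ∀ k, ρ (k + 1) = σ (G.owner (ρ k)) (pre ρ k) := by
  constructor
  · rintro rfl
    exact ⟨rfl, outcome_succ σ v⟩
  · rintro ⟨h0, hs⟩
    have H : ∀ k, ∀ n ≤ k, G.outcome σ v n = ρ n := by
      intro k
      induction k with
      | zero => intro n hn; obtain rfl : n = 0 := by omega
                exact h0.symm
      | succ k ih =>
        intro n hn
        rcases Nat.lt_or_eq_of_le hn with h | rfl
        · exact ih n (by omega)
        · rw [outcome_succ, hs, ih k le_rfl, pre_congr ih]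
    exact funext fun k => H k k le_rfl

theorem outcome_mem_plays {σ : P → List V → V} {v : V} (hσ : G.IsProfile v σ) :
    G.outcome σ v ∈ G.Plays v := by
  have edge : ∀ k, pre (G.outcome σ v) k ∈ G.Hist v →
      G.Edge (G.outcome σ v k) (G.outcome σ v (k + 1)) := by
    intro k hk
    rw [outcome_succ]
    obtain ⟨h, hh⟩ := exists_pre_eq (G.outcome σ v) k
    rw [hh] at hk ⊢
    exact hσ _ h _ (snoc_mem_histOf.2 ⟨hk, rfl⟩)
  have key : ∀ k, pre (G.outcome σ v) k ∈ G.Hist v := by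
    intro k
    induction k with
    | zero => exact singleton_mem_hist.2 rfl
    | succ k ih =>
      have he := edge k ih
      rw [pre_succ]
      obtain ⟨h, hh⟩ := exists_pre_eq (G.outcome σ v) k
      rw [hh] at ih ⊢
      exact snoc_mem_hist.2 ⟨ih, he⟩
  exact ⟨rfl, fun k => edge k (key k)⟩

theorem restrict_restrict {α : Type*} (σ : P → List V → α) (g h : List V) :
    restrict (restrict σ g) h = restrict σ (g ++ h) := by
  funext i l; simp [restrict]

theorem restrict_nil {α : Type*} (σ : P → List V → α) : restrict σ [] = σ := rfl

/-- One move of a profile, followed by the outcome of its restriction. -/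
theorem outcome_eq_cat (σ : P → List V → V) (v : V) :
    G.outcome σ v = cat [v] (G.outcome (restrict σ [v]) (σ (G.owner v) [v])) := by
  rw [outcome_eq_iff]
  refine ⟨rfl, fun k => ?_⟩
  cases k with
  | zero => rfl
  | succ k =>
    rw [cat_singleton_succ, cat_singleton_succ, pre_cat_singleton, outcome_succ]
    rfl

/-! ### Multi-strategies -/

theorem IsMulti.restrict {Θ : P → List V → Set V} {v₀ v : V} {g : List V} (hΘ : G.IsMulti v₀ Θ)
    (hg : g ++ [v] ∈ G.Hist v₀) : G.IsMulti v (restrict Θ g) := by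
  intro i h u hu
  obtain ⟨h1, h2⟩ := snoc_mem_histOf.1 hu
  have h3 := append_mem_hist hg h1
  rw [← List.append_assoc] at h3
  have := hΘ i (g ++ h) u (snoc_mem_histOf.2 ⟨h3, h2⟩)
  simpa [ReachGame.restrict] using this

theorem Consistent.restrict {σ : P → List V → V} {Θ : P → List V → Set V} {v₀ v : V} {g : List V}
    (hσ : G.Consistent v₀ σ Θ) (hg : g ++ [v] ∈ G.Hist v₀) :
    G.Consistent v (restrict σ g) (restrict Θ g) := by
  have key : ∀ i h u, h ++ [u] ∈ G.HistOf i v → g ++ h ++ [u] ∈ G.HistOf i v₀ := by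
    intro i h u hu
    obtain ⟨h1, h2⟩ := snoc_mem_histOf.1 hu
    have h3 := append_mem_hist hg h1
    rw [← List.append_assoc] at h3
    exact snoc_mem_histOf.2 ⟨h3, h2⟩
  constructor
  · intro i h u hu
    simpa [ReachGame.restrict] using hσ.1 i (g ++ h) u (key i h u hu)
  · rintro i _ ⟨h1, h, u, rfl, h2⟩
    simpa [ReachGame.restrict] using hσ.2 i _ (key i h u (snoc_mem_histOf.2 ⟨h1, h2⟩))

/-- A function choosing a move allowed by `Θ` after each history. -/
def Chooses (G : ReachGame P V) (v : V) (Θ : P → List V → Set V) (c : List V → V) : Prop :=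
  ∀ h u, h ++ [u] ∈ G.Hist v → c (h ++ [u]) ∈ Θ (G.owner u) (h ++ [u])

/-- One function serves all players, since only the owner of the last vertex of a history moves
there. -/
theorem Chooses.consistent {Θ : P → List V → Set V} {v : V} {c : List V → V}
    (hΘ : G.IsMulti v Θ) (hc : G.Chooses v Θ c) : G.Consistent v (fun _ => c) Θ := by
  constructor
  · intro i h u hu
    obtain ⟨h1, rfl⟩ := snoc_mem_histOf.1 hu
    exact (hΘ _ h u hu).2 _ (hc h u h1)
  · rintro i _ ⟨h1, h, u, rfl, rfl⟩
    exact hc h u h1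

theorem IsMulti.exists_chooses {Θ : P → List V → Set V} {v : V} (hΘ : G.IsMulti v Θ) :
    ∃ c, G.Chooses v Θ c := by
  have : ∀ l : List V, ∃ a : V, ∀ h u, l = h ++ [u] → h ++ [u] ∈ G.Hist v →
      a ∈ Θ (G.owner u) (h ++ [u]) := by
    intro l
    by_cases hl : ∃ h u, l = h ++ [u] ∧ h ++ [u] ∈ G.Hist v
    · obtain ⟨h, u, rfl, hu⟩ := hl
      obtain ⟨a, ha⟩ := (hΘ _ h u (snoc_mem_histOf.2 ⟨hu, rfl⟩)).1
      refine ⟨a, fun h' u' he _ => ?_⟩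
      obtain ⟨rfl, h2⟩ := List.append_inj' he rfl
      simp only [List.cons.injEq, and_true] at h2
      exact h2 ▸ ha
    · exact ⟨v, fun h u he hu => (hl ⟨h, u, he, hu⟩).elim⟩
  choose c hc using this
  exact ⟨c, fun h u hu => hc _ h u rfl hu⟩

open Classical in
/-- Follow the play `ρ` after `h`, and choose as `c` elsewhere. -/
noncomputable def follow (c : List V → V) (h : List V) (ρ : ℕ → V) (l : List V) : V :=
  -- The length of `l` leaves only one `k` for which `l = h ++ pre ρ k` is possible; the next vertex
  -- is then `ρ (k + 1)`.
  if l = h ++ pre ρ (l.length - h.length - 1) then ρ (l.length - h.length) else c l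

theorem follow_append_pre (c : List V → V) (h : List V) (ρ : ℕ → V) (k : ℕ) :
    follow c h ρ (h ++ pre ρ k) = ρ (k + 1) := by
  simp [follow, length_pre]

theorem follow_of_ne (c : List V → V) {h l : List V} {ρ : ℕ → V}
    (H : ∀ k, l ≠ h ++ pre ρ k) : follow c h ρ l = c l := by
  rw [follow, if_neg (H _)]

theorem Chooses.follow {Θ : P → List V → Set V} {v : V} {c : List V → V} {h : List V} {ρ : ℕ → V}
    (hc : G.Chooses v Θ c)
    (hρ : ∀ k, ρ (k + 1) ∈ Θ (G.owner (ρ k)) (h ++ pre ρ k)) :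
    G.Chooses v Θ (follow c h ρ) := by
  intro g u hu
  by_cases H : ∃ k, g ++ [u] = h ++ pre ρ k
  · obtain ⟨k, hk⟩ := H
    obtain ⟨l, hl⟩ := exists_pre_eq ρ k
    have hk' := hk
    rw [hl, ← List.append_assoc] at hk'
    have h2 := (List.append_inj' hk' rfl).2
    simp only [List.cons.injEq, and_true] at h2
    rw [hk, follow_append_pre, h2]
    exact hρ k
  · rw [follow_of_ne c (not_exists.1 H)]
    exact hc g u hu

/-- Being an outcome is a condition on each move separately: the prefixes of a play are distinct
histories, so one strategy profile can make all its moves. -/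
theorem mem_multiOutcome {Θ : P → List V → Set V} {v : V} (hΘ : G.IsMulti v Θ) {ρ : ℕ → V} :
    ρ ∈ G.multiOutcome Θ v ↔ ρ 0 = v ∧ ∀ k, ρ (k + 1) ∈ Θ (G.owner (ρ k)) (pre ρ k) := by
  constructor
  · rintro ⟨σ, hσ, rfl⟩
    refine ⟨rfl, fun k => ?_⟩
    rw [outcome_succ]
    obtain ⟨h, hh⟩ := exists_pre_eq (G.outcome σ v) k
    exact hσ.2 _ _ ⟨pre_mem_hist (outcome_mem_plays hσ.1) k, h, _, hh, rfl⟩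
  · rintro ⟨h0, hs⟩
    obtain ⟨c, hc⟩ := hΘ.exists_chooses
    refine ⟨_, (hc.follow (h := []) hs).consistent hΘ, ?_⟩
    rw [outcome_eq_iff]
    exact ⟨h0, fun k => (follow_append_pre c [] ρ k).symm⟩

theorem Consistent.outcome_mem {σ : P → List V → V} {Θ : P → List V → Set V} {v : V}
    (hσ : G.Consistent v σ Θ) : G.outcome σ v ∈ G.multiOutcome Θ v := ⟨σ, hσ, rfl⟩

theorem IsMulti.multiOutcome_nonempty {Θ : P → List V → Set V} {v : V} (hΘ : G.IsMulti v Θ) :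
    (G.multiOutcome Θ v).Nonempty := by
  obtain ⟨c, hc⟩ := hΘ.exists_chooses
  exact ⟨_, (hc.consistent hΘ).outcome_mem⟩

theorem multiOutcome_subset_plays {Θ : P → List V → Set V} {v : V} :
    G.multiOutcome Θ v ⊆ G.Plays v := by
  rintro _ ⟨σ, hσ, rfl⟩
  exact outcome_mem_plays hσ.1

theorem cat_mem_multiOutcome {Θ : P → List V → Set V} {v u : V} {h : List V} {ρ : ℕ → V}
    (hΘ : G.IsMulti v Θ) (hh : h ++ [u] ∈ G.multiHist Θ v)
    (hρ : ρ ∈ G.multiOutcome (restrict Θ h) u) : cat h ρ ∈ G.multiOutcome Θ v := by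
  obtain ⟨ρ₁, h1, k, hk⟩ := hh
  have hhist : h ++ [u] ∈ G.Hist v := by
    rw [hk]; exact pre_mem_hist (multiOutcome_subset_plays h1) k
  rw [mem_multiOutcome (hΘ.restrict hhist)] at hρ
  rw [mem_multiOutcome hΘ] at h1 ⊢
  have hlen : h.length = k := by
    have := congrArg List.length hk
    simpa [length_pre] using this
  have hpre : pre (cat h ρ) k = pre ρ₁ k := by
    have := pre_cat h ρ 0
    rw [add_zero, hlen, pre_zero, hρ.1, hk] at this
    exact this
  have hagree : ∀ n ≤ k, cat h ρ n = ρ₁ n := fun n hn => pre_injective_of_eq hpre hn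
  refine ⟨(hagree 0 (Nat.zero_le _)).trans h1.1, fun n => ?_⟩
  rcases lt_or_ge n k with hn | hn
  · rw [hagree (n + 1) hn, hagree n hn.le, pre_congr fun m hm => hagree m (hm.trans hn.le)]
    exact h1.2 n
  · obtain ⟨n, rfl⟩ := Nat.exists_eq_add_of_le hn
    rw [← hlen, add_assoc, cat_add, cat_add, pre_cat]
    exact hρ.2 n

theorem singleton_mem_multiHist {Θ : P → List V → Set V} {v : V} (hΘ : G.IsMulti v Θ) :
    [v] ∈ G.multiHist Θ v := by
  obtain ⟨ρ, hρ⟩ := hΘ.multiOutcome_nonempty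
  refine ⟨ρ, hρ, 0, ?_⟩
  rw [pre_zero, ((mem_multiOutcome hΘ).1 hρ).1]

theorem multiHist_subset_hist {Θ : P → List V → Set V} {v : V} :
    G.multiHist Θ v ⊆ G.Hist v := by
  rintro _ ⟨ρ, hρ, k, rfl⟩
  exact pre_mem_hist (multiOutcome_subset_plays hρ) k

/-- This recursion drives every computation with `multiHist`. From right to left it uses that `Θ`
has non-empty values, so that an allowed move can be continued to a whole outcome. -/
theorem snoc_mem_multiHist {Θ : P → List V → Set V} {v : V} (hΘ : G.IsMulti v Θ) {h : List V}
    {u u' : V} : h ++ [u] ++ [u'] ∈ G.multiHist Θ v ↔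
      h ++ [u] ∈ G.multiHist Θ v ∧ u' ∈ Θ (G.owner u) (h ++ [u]) := by
  constructor
  · rintro ⟨ρ, hρ, k, hk⟩
    cases k with
    | zero => have := congrArg List.length hk; simp [length_pre] at this
    | succ k =>
      rw [pre_succ] at hk
      obtain ⟨h1, h2⟩ := List.append_inj' hk rfl
      simp only [List.cons.injEq, and_true] at h2
      refine ⟨⟨ρ, hρ, k, h1⟩, ?_⟩
      obtain ⟨l, hl⟩ := exists_pre_eq ρ k
      have h3 := h1
      rw [hl] at h3
      have h4 := (List.append_inj' h3 rfl).2
      simp only [List.cons.injEq, and_true] at h4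
      rw [h1, h2, h4]
      exact ((mem_multiOutcome hΘ).1 hρ).2 k
  · rintro ⟨h1, h2⟩
    have hu := multiHist_subset_hist h1
    have he := (hΘ _ h u (snoc_mem_histOf.2 ⟨hu, rfl⟩)).2 _ h2
    have hu' := snoc_mem_hist.2 ⟨hu, he⟩
    obtain ⟨ρ, hρ⟩ := (hΘ.restrict hu').multiOutcome_nonempty
    have hρ' := (mem_multiOutcome (hΘ.restrict hu')).1 hρ
    have hΘh := hΘ.restrict hu
    have h3 : cat [u] ρ ∈ G.multiOutcome (restrict Θ h) u := by
      rw [mem_multiOutcome hΘh]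
      refine ⟨rfl, fun k => ?_⟩
      cases k with
      | zero => rw [cat_singleton_succ, hρ'.1]; exact h2
      | succ k =>
        rw [cat_singleton_succ, cat_singleton_succ, pre_cat_singleton]
        simpa [restrict] using hρ'.2 k
    refine ⟨_, cat_mem_multiOutcome hΘ h1 h3, h.length + 1, ?_⟩
    rw [pre_cat, pre_cat_singleton, pre_zero, hρ'.1]
    simp

theorem cat_singleton_mem_multiOutcome {Θ : P → List V → Set V} {v v₁ : V} {ρ : ℕ → V}
    (hΘ : G.IsMulti v Θ) (hv : v₁ ∈ Θ (G.owner v) [v])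
    (hρ : ρ ∈ G.multiOutcome (restrict Θ [v]) v₁) : cat [v] ρ ∈ G.multiOutcome Θ v :=
  cat_mem_multiOutcome hΘ ((snoc_mem_multiHist hΘ (h := [])).2 ⟨singleton_mem_multiHist hΘ, hv⟩) hρ

theorem tail_mem_multiOutcome {Θ : P → List V → Set V} {v : V} {ρ : ℕ → V}
    (hΘ : G.IsMulti v Θ) (hρ : ρ ∈ G.multiOutcome Θ v) :
    (fun k => ρ (k + 1)) ∈ G.multiOutcome (restrict Θ [v]) (ρ 1) := by
  have h1 := (mem_multiOutcome hΘ).1 hρ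
  have h2 : [v] ++ [ρ 1] ∈ G.Hist v := by
    have := pre_mem_hist (multiOutcome_subset_plays hρ) 1
    rwa [pre_succ, pre_zero, h1.1] at this
  rw [mem_multiOutcome (hΘ.restrict h2)]
  refine ⟨rfl, fun k => ?_⟩
  have h3 := h1.2 (k + 1)
  rw [← cat_tail ρ, pre_cat_singleton, h1.1] at h3
  simpa [cat_singleton_succ, restrict] using h3

theorem mem_multiHist_restrict {Θ : P → List V → Set V} {v₀ v : V} (hΘ : G.IsMulti v₀ Θ)
    {g h : List V} (hg : g ++ [v] ∈ G.multiHist Θ v₀) (hh : h ∈ G.Hist v) :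
    h ∈ G.multiHist (restrict Θ g) v ↔ g ++ h ∈ G.multiHist Θ v₀ := by
  have hΘg := hΘ.restrict (multiHist_subset_hist hg)
  obtain ⟨h, u, rfl⟩ := exists_snoc_of_mem_hist hh
  refine hist_induction (p := fun h u => h ++ [u] ∈ G.multiHist (restrict Θ g) v ↔
    g ++ (h ++ [u]) ∈ G.multiHist Θ v₀) ?_ ?_ h u hh
  · exact iff_of_true (singleton_mem_multiHist hΘg) hg
  · intro h u u' _ _ ih
    rw [snoc_mem_multiHist hΘg, ih, ← List.append_assoc, ← List.append_assoc, ← List.append_assoc,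
      snoc_mem_multiHist hΘ]
    simp [restrict]

theorem subtree_multiHist {Θ : P → List V → Set V} {v₀ v : V} (hΘ : G.IsMulti v₀ Θ)
    {g : List V} (hg : g ++ [v] ∈ G.multiHist Θ v₀) :
    G.subtree (G.multiHist Θ v₀) g v = G.multiHist (restrict Θ g) v := by
  have hΘg := hΘ.restrict (multiHist_subset_hist hg)
  ext h
  constructor
  · rintro ⟨h1, h2⟩
    exact (mem_multiHist_restrict hΘ hg h1).2 h2
  · intro h1
    have h2 := multiHist_subset_hist h1
    exact ⟨h2, (mem_multiHist_restrict hΘ hg h2).1 h1⟩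

/-- The set of outcomes is closed: by `mem_multiOutcome`, membership is tested on finite prefixes,
so the tree has no additional branches. -/
theorem branches_multiHist {Θ : P → List V → Set V} {v : V} (hΘ : G.IsMulti v Θ) :
    G.branches v (G.multiHist Θ v) = G.multiOutcome Θ v := by
  ext ρ
  constructor
  · rintro ⟨h1, h2⟩
    rw [mem_multiOutcome hΘ]
    refine ⟨h1.1, fun k => ?_⟩
    have h3 := h2 (k + 1)
    rw [pre_succ] at h3
    obtain ⟨h, hh⟩ := exists_pre_eq ρ k
    rw [hh] at h3 ⊢
    exact ((snoc_mem_multiHist hΘ).1 h3).2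
  · intro h
    exact ⟨multiOutcome_subset_plays h, fun k => ⟨ρ, h, k, rfl⟩⟩

theorem isTree_multiHist {Θ : P → List V → Set V} {v : V} (hΘ : G.IsMulti v Θ) :
    G.IsTree v (G.multiHist Θ v) := by
  refine ⟨multiHist_subset_hist, singleton_mem_multiHist hΘ, fun h u hne hu => ?_⟩
  rcases List.eq_nil_or_concat h with rfl | ⟨h', u', rfl⟩
  · exact (hne rfl).elim
  · rw [List.concat_eq_append] at hu ⊢
    exact ((snoc_mem_multiHist hΘ).1 hu).1

theorem noLeaves_multiHist {Θ : P → List V → Set V} {v : V} :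
    NoLeaves (G.multiHist Θ v) := by
  rintro _ ⟨ρ, hρ, k, rfl⟩
  exact ⟨ρ (k + 1), ρ, hρ, k + 1, (pre_succ ρ k).symm⟩

/-! ### Penalties -/

theorem treePenalty_multiHist [Fintype V] {Θ : P → List V → Set V} {v : V} (hΘ : G.IsMulti v Θ)
    (i : P) : G.treePenalty v (G.multiHist Θ v) i = ⨆ ρ ∈ G.multiOutcome Θ v, G.penal Θ i ρ := by
  unfold treePenalty penal
  rw [branches_multiHist hΘ]
  refine biSup_congr fun ρ hρ => iSup_congr fun k => ?_
  congr 1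
  induction k with
  | zero => rfl
  | succ k ih =>
    rw [treePenalPre, penalPre, ih]
    split_ifs with ho
    · congr 2
      ext u
      have hk : pre ρ k ∈ G.multiHist Θ v := ⟨ρ, hρ, k, rfl⟩
      obtain ⟨h, hh⟩ := exists_pre_eq ρ k
      rw [Set.mem_ofPred_eq]
      rw [hh] at hk ⊢
      rw [snoc_mem_multiHist hΘ, ho]
      exact and_iff_right hk
    · rfl

theorem penalPre_restrict_le [Fintype V] (Θ : P → List V → Set V) (i : P) (h : List V)
    (ρ : ℕ → V) (k : ℕ) :
    G.penalPre (restrict Θ h) i ρ k ≤ G.penalPre Θ i (cat h ρ) (h.length + k) := by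
  induction k with
  | zero => exact Nat.zero_le _
  | succ k ih =>
    rw [← add_assoc, penalPre, penalPre, cat_add, pre_cat]
    exact Nat.add_le_add_right ih _

theorem penalPre_succ_eq [Fintype V] (Θ : P → List V → Set V) {i : P} {ρ : ℕ → V}
    (hi : G.owner (ρ 0) ≠ i) (k : ℕ) :
    G.penalPre Θ i ρ (k + 1) = G.penalPre (restrict Θ [ρ 0]) i (fun n => ρ (n + 1)) k := by
  induction k with
  | zero => simp [penalPre, hi]
  | succ k ih =>
    rw [penalPre, ih, penalPre]
    have : pre ρ (k + 1) = ρ 0 :: pre (fun n => ρ (n + 1)) k := by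
      conv_lhs => rw [← cat_tail ρ, pre_cat_singleton]
    rw [this]
    rfl

/-! ### One-shot deviations -/

/-- If the owner of `v` reaches his target set after moving from `v` to `v₁`, then he does so
in all outcomes that make another move. -/
def NoOneShotDeviation (G : ReachGame P V) (v₀ : V) (Θ : P → List V → Set V) : Prop :=
  ∀ h v v₁, h ++ [v] ∈ G.Hist v₀ → G.owner v ∉ G.visit (h ++ [v]) → G.Edge v v₁ →
    ∀ ρ₁ ∈ G.multiOutcome (restrict Θ (h ++ [v])) v₁, G.gain (G.owner v) ρ₁ = 1 →
    ∀ ρ ∈ G.multiOutcome (restrict Θ h) v, ρ 1 ≠ v₁ → G.gain (G.owner v) ρ = 1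

/-- A consistent profile is built that follows `ρ` after `h` and `ρ₁` after `h ++ [v]`. A single
move to `v₁` then exchanges the first outcome for the second, and the equilibrium property compares
the gains. -/
theorem IsPermissiveSPE.noOneShotDeviation {Θ : P → List V → Set V} {v₀ : V}
    (hΘ : G.IsPermissiveSPE v₀ Θ) : G.NoOneShotDeviation v₀ Θ := by
  classical
  obtain ⟨hM, hS⟩ := hΘ
  intro h v v₁ hv hvis he ρ₁ hρ₁ hg ρ hρ hne
  have hv₁ := snoc_mem_hist.2 ⟨hv, he⟩
  have h₁ := (mem_multiOutcome (hM.restrict hv₁)).1 hρ₁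
  have h₂ := (mem_multiOutcome (hM.restrict hv)).1 hρ
  obtain ⟨c₀, hc₀⟩ := hM.exists_chooses
  have hc₁ := hc₀.follow (h := h ++ [v]) h₁.2
  have hc := hc₁.follow (h := h) h₂.2
  set c₁ := follow c₀ (h ++ [v]) ρ₁ with hc₁_def
  set c := follow c₁ h ρ with hc_def
  -- The two plays separate right after `v`, because `ρ 1 ≠ v₁`, so the outer override does not
  -- disturb the inner one.
  have hne' : ∀ k n, h ++ [v] ++ pre ρ₁ k ≠ h ++ pre ρ n := by
    intro k n H
    rw [List.append_assoc, List.append_cancel_left_eq, List.singleton_append,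
      ← pre_cat_singleton] at H
    have hl := congrArg List.length H
    simp only [length_pre] at hl
    obtain rfl : n = k + 1 := by omega
    have := pre_injective_of_eq H (n := 1) (by omega)
    rw [cat_singleton_succ, h₁.1] at this
    exact hne this.symm
  have hout : G.outcome (restrict (fun _ => c) h) v = ρ := by
    rw [outcome_eq_iff]
    exact ⟨h₂.1, fun k => (follow_append_pre c₁ h ρ k).symm⟩
  let s : List V → V := fun l => if l = [v] then v₁ else c (h ++ l)
  have hs : G.IsStrategy v (G.owner v) s := by
    intro l u hu
    obtain ⟨hl, hu'⟩ := snoc_mem_histOf.1 hu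
    by_cases hlu : l ++ [u] = [v]
    · obtain rfl : u = v := by
        have := List.append_inj_right' (s₁ := l) (s₂ := []) hlu rfl
        simpa using this
      simpa [s, hlu] using he
    · have h3 := append_mem_hist hv hl
      rw [← List.append_assoc] at h3
      have := (hc.consistent hM).1 _ _ _ (snoc_mem_histOf.2 ⟨h3, hu'⟩)
      simpa [s, hlu] using this
  have hdev : G.outcome (Function.update (restrict (fun _ => c) h) (G.owner v) s) v =
      cat [v] ρ₁ := by
    rw [outcome_eq_iff]
    refine ⟨rfl, fun k => ?_⟩
    have hupd : ∀ (j : P) (l : List V), l ≠ [v] →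
        Function.update (restrict (fun _ => c) h) (G.owner v) s j l = c (h ++ l) := by
      intro j l hl
      by_cases hj : j = G.owner v
      · subst hj; simp [s, hl]
      · simp [Function.update_of_ne hj, restrict]
    cases k with
    | zero => rw [cat_singleton_succ, h₁.1, pre_zero, cat_singleton_zero]; simp [s]
    | succ k =>
      rw [pre_cat_singleton, hupd _ _ (by simp [pre]), cat_singleton_succ]
      have : h ++ v :: pre ρ₁ k = h ++ [v] ++ pre ρ₁ k := by simp
      rw [this, hc_def, follow_of_ne c₁ (hne' k), hc₁_def, follow_append_pre]
  have hNE := hS _ (hc.consistent hM) h v hv (G.owner v) s hs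
  rw [hdev, hout] at hNE
  have h4 : G.gain (G.owner v) (cat h (cat [v] ρ₁)) = 1 :=
    gain_cat.2 (Or.inr (gain_cat.2 (Or.inr hg)))
  rw [h4] at hNE
  refine (gain_cat.1 (le_antisymm (gain_le_one _ _) hNE)).resolve_left fun H => hvis ?_
  rw [visit_append]
  exact Or.inl H

/-- Induction on the time at which the deviating play reaches the target. No limit argument is
needed, since a win is witnessed at a finite time. -/
theorem NoOneShotDeviation.isPermissiveSPE {Θ : P → List V → Set V} {v₀ : V}
    (hM : G.IsMulti v₀ Θ) (hΘ : G.NoOneShotDeviation v₀ Θ) : G.IsPermissiveSPE v₀ Θ := by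
  classical
  refine ⟨hM, fun σ hσ h v hv i s hs => ?_⟩
  -- The deviation is recorded only as a play `ρ` that obeys `σ` at the vertices of the other
  -- players; this form passes to tails.
  have key : ∀ n h v (ρ : ℕ → V), h ++ [v] ∈ G.Hist v₀ → ρ 0 = v →
      (∀ k, G.Edge (ρ k) (ρ (k + 1))) →
      (∀ k, G.owner (ρ k) ≠ i → ρ (k + 1) = σ (G.owner (ρ k)) (h ++ pre ρ k)) →
      i ∉ G.visit h → ρ n ∈ G.target i → G.gain i (G.outcome (restrict σ h) v) = 1 := by
    intro n
    induction n with
    | zero =>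
      rintro h v ρ hv rfl - - - ht
      exact gain_eq_one.2 ⟨0, ht⟩
    | succ n ih =>
      rintro h v ρ hv h0 hed hdev hvis ht
      by_cases hvt : v ∈ G.target i
      · exact gain_eq_one.2 ⟨0, hvt⟩
      have hvis' : i ∉ G.visit (h ++ [v]) := by
        rw [visit_append]
        rintro (H | ⟨u, hu, hut⟩)
        · exact hvis H
        · rw [List.mem_singleton] at hu
          exact hvt (hu ▸ hut)
      have he : G.Edge v (ρ 1) := h0 ▸ hed 0
      have hv₁ := snoc_mem_hist.2 ⟨hv, he⟩
      have h1 := ih (h ++ [v]) (ρ 1) (fun k => ρ (k + 1)) hv₁ rfl (fun k => hed (k + 1))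
        (fun k hk => by
          have := hdev (k + 1) hk
          have hp : pre ρ (k + 1) = v :: pre (fun n => ρ (n + 1)) k := by
            conv_lhs => rw [← cat_tail ρ, pre_cat_singleton, h0]
          rw [hp] at this
          simpa using this) hvis' ht
      have h2 := outcome_eq_cat (G := G) (restrict σ h) v
      rw [restrict_restrict] at h2
      by_cases hmove : restrict σ h (G.owner v) [v] = ρ 1
      · rw [h2, hmove]
        exact gain_cat.2 (Or.inr h1)
      -- The first move of `ρ` differs from that of `σ`, so `i` makes it. By induction `σ` wins for
      -- `i` after that move, hence also after its own.
      · have ho : G.owner v = i := by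
          by_contra ho
          have := hdev 0 (by rwa [h0])
          rw [h0, pre_zero, h0] at this
          exact hmove this.symm
        subst ho
        refine hΘ h v (ρ 1) hv hvis' he _ (hσ.restrict hv₁).outcome_mem h1 _
          (hσ.restrict hv).outcome_mem ?_
        rw [h2, cat_singleton_succ]
        exact hmove
  by_cases hg : G.gain i (cat h (G.outcome (Function.update (restrict σ h) i s) v)) = 1
  · rw [hg]
    refine le_of_eq (Eq.symm (gain_cat.2 ?_))
    by_cases hvis : i ∈ G.visit h
    · exact Or.inl hvis
    right
    obtain ⟨n, hn⟩ := gain_eq_one.1 ((gain_cat.1 hg).resolve_left hvis)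
    set τ := Function.update (restrict σ h) i s with hτ
    have hprof : G.IsProfile v τ := by
      intro j
      by_cases hj : j = i
      · subst hj; rw [hτ, Function.update_self]; exact hs
      · rw [hτ, Function.update_of_ne hj]; exact (hσ.restrict hv).1 j
    refine key n h v _ hv rfl (outcome_mem_plays hprof).2 (fun k hk => ?_) hvis hn
    rw [outcome_succ, hτ, Function.update_of_ne hk]
    rfl
  · have := gain_le_one (G := G) i (cat h (G.outcome (Function.update (restrict σ h) i s) v))
    omega

/-! ### From permissive equilibria to good forests -/

theorem IsTree.mem_of_append_mem {T : Set (List V)} {v₀ v : V} (hT : G.IsTree v₀ T)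
    {g h : List V} (hh : h ∈ G.Hist v) (hgh : g ++ h ∈ T) : g ++ [v] ∈ T := by
  obtain ⟨h, u, rfl⟩ := exists_snoc_of_mem_hist hh
  refine hist_induction (p := fun h u => g ++ (h ++ [u]) ∈ T → g ++ [v] ∈ T) id ?_ h u hh hgh
  intro h u u' _ _ ih hu'
  rw [← List.append_assoc] at hu'
  exact ih (hT.2.2 _ _ (by simp) hu')

theorem visit_append_of_mem_hist {g h : List V} {v : V} (hh : h ∈ G.Hist v) :
    G.visit (g ++ h) = G.visit (g ++ [v]) ∪ G.visit h := by
  have hv : v ∈ h := List.mem_of_mem_head? hh.1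
  have : G.visit [v] ⊆ G.visit h := by
    rintro i ⟨u, hu, ht⟩
    rw [List.mem_singleton] at hu
    exact ⟨u, hu ▸ hv, ht⟩
  rw [visit_append, visit_append, Set.union_assoc, Set.union_eq_right.2 this]

theorem mem_indices_of_hist {h : List V} {v' v v₀ : V} (hv : h ++ [v'] ++ [v] ∈ G.Hist v₀) :
    (some (G.owner v'), v, G.visit (h ++ [v'] ++ [v])) ∈ G.Indices v₀ :=
  Or.inr ⟨_, h, v', v, snoc_mem_histOf.2 ⟨(snoc_mem_hist.1 hv).1, rfl⟩, (snoc_mem_hist.1 hv).2, rfl⟩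

/-- `g` is a history after which player `j` moves to `v`, and then `I` is the set of the players
who have visited their target sets. -/
def Represents (G : ReachGame P V) (v₀ : V) (j : P) (v : V) (I : Set P) (g : List V) : Prop :=
  g ++ [v] ∈ G.Hist v₀ ∧ G.visit (g ++ [v]) = I ∧ ∃ h v', g = h ++ [v'] ∧ G.owner v' = j

/-- A history for each tree index: a deviation from `Θ` if possible, and one after which the
deviating player reaches his target set only if he does so after all such deviations. -/
theorem exists_representatives (G : ReachGame P V) (v₀ : V) (Θ : P → List V → Set V) :
    ∃ rep : Index P V → List V, rep (G.rootIndex v₀) = [] ∧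
      (∀ x ∈ G.Indices v₀, rep x ++ [x.2.1] ∈ G.Hist v₀ ∧ G.visit (rep x ++ [x.2.1]) = x.2.2) ∧
      ∀ j v I g, G.Represents v₀ j v I g → g ++ [v] ∉ G.multiHist Θ v₀ →
        rep (some j, v, I) ++ [v] ∉ G.multiHist Θ v₀ ∧
        ((∃ ρ ∈ G.multiOutcome (restrict Θ (rep (some j, v, I))) v, G.gain j ρ = 1) →
          ∃ ρ ∈ G.multiOutcome (restrict Θ g) v, G.gain j ρ = 1) := by
  have : ∀ j v I, ∃ g₀, (∀ g, G.Represents v₀ j v I g → G.Represents v₀ j v I g₀) ∧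
      ∀ g, G.Represents v₀ j v I g → g ++ [v] ∉ G.multiHist Θ v₀ →
        g₀ ++ [v] ∉ G.multiHist Θ v₀ ∧
        ((∃ ρ ∈ G.multiOutcome (restrict Θ g₀) v, G.gain j ρ = 1) →
          ∃ ρ ∈ G.multiOutcome (restrict Θ g) v, G.gain j ρ = 1) := by
    intro j v I
    -- First choice: a deviation after which `j` never wins, which makes the implication vacuous. If
    -- none exists, `j` can win after every deviation, and any of them will do.
    by_cases h1 : ∃ g, G.Represents v₀ j v I g ∧ g ++ [v] ∉ G.multiHist Θ v₀ ∧
        ¬ ∃ ρ ∈ G.multiOutcome (restrict Θ g) v, G.gain j ρ = 1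
    · obtain ⟨g, hg, hd, hn⟩ := h1
      exact ⟨g, fun _ _ => hg, fun _ _ _ => ⟨hd, fun h => (hn h).elim⟩⟩
    by_cases h2 : ∃ g, G.Represents v₀ j v I g ∧ g ++ [v] ∉ G.multiHist Θ v₀
    · obtain ⟨g, hg, hd⟩ := h2
      refine ⟨g, fun _ _ => hg, fun g' hg' hd' => ⟨hd, fun _ => ?_⟩⟩
      by_contra hn
      exact h1 ⟨g', hg', hd', hn⟩
    by_cases h3 : ∃ g, G.Represents v₀ j v I g
    · obtain ⟨g, hg⟩ := h3
      exact ⟨g, fun _ _ => hg, fun g' hg' hd' => (h2 ⟨g', hg', hd'⟩).elim⟩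
    · exact ⟨[], fun g hg => (h3 ⟨g, hg⟩).elim, fun g hg => (h3 ⟨g, hg⟩).elim⟩
  choose f hf using this
  refine ⟨fun x => x.1.elim [] fun j => f j x.2.1 x.2.2, rfl, ?_, fun j v I => (hf j v I).2⟩
  rintro x (hx | ⟨j, h, v', v, hh, he, rfl⟩)
  · rw [Set.mem_singleton_iff] at hx
    subst hx
    refine ⟨singleton_mem_hist.2 rfl, ?_⟩
    ext i
    simp [rootIndex, visit]
  · obtain ⟨h1, h2⟩ := snoc_mem_histOf.1 hh
    have hr : G.Represents v₀ j v (G.visit (h ++ [v'] ++ [v])) (h ++ [v']) :=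
      ⟨snoc_mem_hist.2 ⟨h1, he⟩, rfl, h, v', rfl, h2⟩
    have := (hf _ _ _).1 _ hr
    exact ⟨this.1, this.2.1⟩

/-- The tail of `ρ` is itself an outcome after the move to `ρ 1`, so it can serve as the winning
outcome in the local condition. -/
theorem NoOneShotDeviation.gain_eq_one_of_ne {Θ : P → List V → Set V} {v₀ v : V}
    (hM : G.IsMulti v₀ Θ) (hN : G.NoOneShotDeviation v₀ Θ) {g : List V}
    (hg : g ++ [v] ∈ G.Hist v₀) (hvis : G.owner v ∉ G.visit (g ++ [v])) {ρ ρ' : ℕ → V}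
    (hρ : ρ ∈ G.multiOutcome (restrict Θ g) v) (hρ' : ρ' ∈ G.multiOutcome (restrict Θ g) v)
    (hne : ρ' 1 ≠ ρ 1) (h1 : G.gain (G.owner v) ρ = 1) : G.gain (G.owner v) ρ' = 1 := by
  have hplay := multiOutcome_subset_plays hρ
  have ht := tail_mem_multiOutcome (hM.restrict hg) hρ
  rw [restrict_restrict] at ht
  refine hN g v (ρ 1) hg hvis (hplay.1 ▸ hplay.2 0) _ ht ?_ ρ' hρ' hne
  rw [← cat_tail ρ, gain_cat, hplay.1] at h1
  refine h1.resolve_left fun H => hvis ?_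
  rw [visit_append]
  exact Or.inr H

/-- The penalties after deviations from `Θ` are bounded by the retaliation penalty, whoever owns
the first vertex. -/
theorem penalPre_le_retaliationPenalty [Fintype V] {Θ : P → List V → Set V} {v₀ : V}
    (hM : G.IsMulti v₀ Θ) (i : P) (k : ℕ) {g : List V} {v : V} {ρ : ℕ → V}
    (hg : g ++ [v] ∈ G.Hist v₀) (hd : g ++ [v] ∉ G.multiHist Θ v₀)
    (hρ : ρ ∈ G.multiOutcome (restrict Θ g) v) :
    (G.penalPre (restrict Θ g) i ρ k : ℕ∞) ≤ G.retaliationPenalty Θ v₀ i := by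
  induction k generalizing g v ρ with
  | zero => simp [penalPre]
  | succ k ih =>
    by_cases ho : G.owner v = i
    · unfold retaliationPenalty
      refine le_iSup_of_le g (le_iSup_of_le v (le_iSup_of_le ⟨snoc_mem_histOf.2 ⟨hg, ho⟩, hd⟩
        (le_iSup₂_of_le ρ hρ ?_)))
      exact le_iSup (fun k => (G.penalPre (restrict Θ g) i ρ k : ℕ∞)) (k + 1)
    -- The first vertex costs `i` nothing. Its successor again ends a history outside `Hist(Θ, v₀)`,
    -- so the bound passes to the tail.
    · have hplay := multiOutcome_subset_plays hρ
      have ht := tail_mem_multiOutcome (hM.restrict hg) hρ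
      rw [restrict_restrict] at ht
      rw [penalPre_succ_eq _ (by rwa [hplay.1]), hplay.1, restrict_restrict]
      exact ih (snoc_mem_hist.2 ⟨hg, hplay.1 ▸ hplay.2 0⟩)
        (fun H => hd ((snoc_mem_multiHist hM).1 H).1) ht

theorem IsPermissiveSPE.exists_isGoodForest [Fintype V] {Θ : P → List V → Set V} {v₀ : V}
    (hΘ : G.IsPermissiveSPE v₀ Θ) :
    ∃ F, G.IsGoodForest v₀ F ∧ F (G.rootIndex v₀) = G.multiHist Θ v₀ ∧
      ∀ i, G.forestRetaliationPenalty v₀ F i ≤ G.retaliationPenalty Θ v₀ i := by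
  have hM := hΘ.1
  have hN := hΘ.noOneShotDeviation
  obtain ⟨rep, hroot, hrep, hdev⟩ := exists_representatives G v₀ Θ
  have hMx : ∀ x ∈ G.Indices v₀, G.IsMulti x.2.1 (restrict Θ (rep x)) :=
    fun x hx => hM.restrict (hrep x hx).1
  have hsub : ∀ x ∈ G.Indices v₀, ∀ h v, h ++ [v] ∈ G.multiHist (restrict Θ (rep x)) x.2.1 →
      G.branches v (G.subtree (G.multiHist (restrict Θ (rep x)) x.2.1) h v) =
        G.multiOutcome (restrict Θ (rep x ++ h)) v := by
    intro x hx h v hv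
    have := (hMx x hx).restrict (multiHist_subset_hist hv)
    rw [subtree_multiHist (hMx x hx) hv, branches_multiHist this, restrict_restrict]
  have hvisit : ∀ x ∈ G.Indices v₀, ∀ h ∈ G.Hist x.2.1,
      G.visit (rep x ++ h) = x.2.2 ∪ G.visit h := by
    intro x hx h hh
    rw [visit_append_of_mem_hist hh, (hrep x hx).2]
  refine ⟨fun x => G.multiHist (restrict Θ (rep x)) x.2.1,
    ⟨fun x hx => ⟨isTree_multiHist (hMx x hx), noLeaves_multiHist⟩, fun x hx => ⟨?_, ?_⟩⟩, ?_, ?_⟩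
  · rintro _ hi h v hv rfl hnt
    rw [hsub x hx h v hv]
    have hvh := multiHist_subset_hist hv
    have hg : rep x ++ h ++ [v] ∈ G.Hist v₀ := by
      rw [List.append_assoc]; exact append_mem_hist (hrep x hx).1 hvh
    suffices H : ∀ ρ ∈ G.multiOutcome (restrict Θ (rep x ++ h)) v,
        ∀ ρ' ∈ G.multiOutcome (restrict Θ (rep x ++ h)) v,
        G.gain (G.owner v) (cat h ρ) = 1 → G.gain (G.owner v) (cat h ρ') = 1 by
      intro ρ hρ ρ' hρ'
      have h1 := gain_le_one (G := G) (G.owner v) (cat h ρ)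
      have h2 := gain_le_one (G := G) (G.owner v) (cat h ρ')
      have h3 := H ρ hρ ρ' hρ'
      have h4 := H ρ' hρ' ρ hρ
      omega
    intro ρ hρ ρ' hρ' hgain
    by_cases hvis : G.owner v ∈ G.visit (h ++ [v])
    · have hplay := multiOutcome_subset_plays hρ'
      rw [← cat_tail ρ', hplay.1, gain_cat, gain_cat]
      rw [visit_append] at hvis
      exact hvis.imp_right Or.inl
    have hvis' : G.owner v ∉ G.visit (rep x ++ h ++ [v]) := by
      rw [List.append_assoc, hvisit x hx _ hvh]
      rintro (H | H)
      exacts [hi H, hvis H]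
    have hρ1 : G.gain (G.owner v) ρ = 1 := by
      refine (gain_cat.1 hgain).resolve_left fun H => hvis ?_
      rw [visit_append]; exact Or.inl H
    refine gain_cat.2 (Or.inr ?_)
    by_cases hne : ρ' 1 = ρ 1
    -- Outcomes with the same first move cannot be compared directly; a third outcome through
    -- another child `c` links them.
    · obtain ⟨c, hc, hc1⟩ := hnt.exists_ne (ρ 1)
      have hcΘ := ((snoc_mem_multiHist (hMx x hx)).1 hc).2
      have hMv := hM.restrict hg
      have hch := append_mem_hist (hrep x hx).1 (multiHist_subset_hist hc)
      rw [← List.append_assoc, ← List.append_assoc] at hch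
      obtain ⟨ρ₂, hρ₂⟩ := (hM.restrict hch).multiOutcome_nonempty
      have h2 : cat [v] ρ₂ ∈ G.multiOutcome (restrict Θ (rep x ++ h)) v := by
        refine cat_singleton_mem_multiOutcome (v₁ := c) hMv ?_ ?_
        · simpa [restrict] using hcΘ
        · rwa [restrict_restrict]
      have h21 : cat [v] ρ₂ 1 = c := by
        rw [cat_singleton_succ]; exact (multiOutcome_subset_plays hρ₂).1
      have h3 := hN.gain_eq_one_of_ne hM hg hvis' hρ h2 (by rwa [h21]) hρ1
      exact hN.gain_eq_one_of_ne hM hg hvis' h2 hρ' (by rw [h21, hne]; exact hc1.symm) h3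
    · exact hN.gain_eq_one_of_ne hM hg hvis' hρ hρ' hne hρ1
  · rintro h u _ hu rfl hj u' he hu' ⟨ρ', hρ', hgain⟩
    rw [hsub x hx h u hu]
    have huh := multiHist_subset_hist hu
    have huh' := snoc_mem_hist.2 ⟨huh, he⟩
    have hg' : rep x ++ (h ++ [u] ++ [u']) ∈ G.Hist v₀ := append_mem_hist (hrep x hx).1 huh'
    have hvis := hvisit x hx _ huh'
    -- Leaving the tree of `x` also leaves `Hist(Θ, v₀)`: otherwise the root of that tree would lie
    -- in `Hist(Θ, v₀)`, and the tree would be the subtree there.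
    have hnot : rep x ++ (h ++ [u] ++ [u']) ∉ G.multiHist Θ v₀ := fun H =>
      hu' ((mem_multiHist_restrict hM ((isTree_multiHist hM).mem_of_append_mem huh' H) huh').2 H)
    rw [← hvis] at hρ'
    simp only [← List.append_assoc] at hg' hnot hρ'
    have hg := (snoc_mem_hist.1 hg').1
    have hR : G.Represents v₀ (G.owner u) u' (G.visit (rep x ++ h ++ [u] ++ [u']))
        (rep x ++ h ++ [u]) := ⟨hg', rfl, _, u, rfl, rfl⟩
    rw [branches_multiHist (hMx _ (mem_indices_of_hist hg'))] at hρ'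
    -- The choice of representatives transfers the win from the tree of the deviation to the actual
    -- history.
    obtain ⟨ρ₁, hρ₁, hgain₁⟩ := (hdev _ _ _ _ hR hnot).2 ⟨ρ', hρ', hgain⟩
    intro ρ hρ
    refine hN _ u u' hg ?_ he ρ₁ hρ₁ hgain₁ ρ hρ ?_
    · rw [List.append_assoc, hvisit x hx _ huh]
      exact hj
    · rintro rfl
      refine hu' ((snoc_mem_multiHist (hMx x hx)).2 ⟨hu, ?_⟩)
      have h0 := (mem_multiOutcome (hM.restrict hg)).1 hρ
      have := h0.2 0
      rw [pre_zero, h0.1] at this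
      simpa [restrict] using this
  · change G.multiHist (restrict Θ (rep (G.rootIndex v₀))) v₀ = _
    rw [hroot, restrict_nil]
  · intro i
    refine iSup₂_le ?_
    rintro _ ⟨_, h, v', v, hv, hnot, rfl, rfl⟩
    change h ++ [v'] ++ [v] ∉ G.multiHist (restrict Θ (rep (G.rootIndex v₀))) v₀ at hnot
    rw [hroot, restrict_nil] at hnot
    have hx := mem_indices_of_hist hv
    have hd := (hdev _ _ _ (h ++ [v']) ⟨hv, rfl, h, v', rfl, rfl⟩ hnot).1
    rw [treePenalty_multiHist (hMx _ hx)]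
    exact iSup₂_le fun ρ hρ => iSup_le fun k =>
      penalPre_le_retaliationPenalty hM i k (hrep _ hx).1 hd hρ

/-! ### From good forests to permissive equilibria -/

open Classical in
/-- One step in a forest: stay in the current tree if possible, else go to the root of the tree
for this deviation. A position `(x, h, u)` is the node `hu` of the tree with index `x`. -/
noncomputable def forestStep (G : ReachGame P V) (F : Index P V → Set (List V))
    (s : Index P V × List V × V) (u' : V) : Index P V × List V × V :=
  if s.2.1 ++ [s.2.2] ++ [u'] ∈ F s.1 then (s.1, s.2.1 ++ [s.2.2], u')
  else ((some (G.owner s.2.2), u', s.1.2.2 ∪ G.visit (s.2.1 ++ [s.2.2] ++ [u'])), [], u')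

/-- The position in the forest `F` after a history. -/
noncomputable def forestPos (G : ReachGame P V) (v₀ : V) (F : Index P V → Set (List V))
    (l : List V) : Index P V × List V × V :=
  -- The first vertex is dropped because the starting position is already at `v₀`.
  l.tail.foldl (G.forestStep F) (G.rootIndex v₀, [], v₀)

theorem forestPos_snoc (v₀ : V) (F : Index P V → Set (List V)) (h : List V) (u u' : V) :
    G.forestPos v₀ F (h ++ [u] ++ [u']) = G.forestStep F (G.forestPos v₀ F (h ++ [u])) u' := by
  rw [forestPos, List.tail_append_of_ne_nil (by simp), List.foldl_append]
  rfl

/-- The multi-strategy profile that stays in the current tree of a forest. -/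
def forestMulti (G : ReachGame P V) (v₀ : V) (F : Index P V → Set (List V)) :
    P → List V → Set V := fun _ l =>
  {u' | (G.forestPos v₀ F l).2.1 ++ [(G.forestPos v₀ F l).2.2] ++ [u'] ∈ F (G.forestPos v₀ F l).1}

theorem mem_forestMulti {v₀ : V} {F : Index P V → Set (List V)} {i : P} {l h' : List V} {u u' : V}
    {x : Index P V} (H : G.forestPos v₀ F l = (x, h', u)) :
    u' ∈ G.forestMulti v₀ F i l ↔ h' ++ [u] ++ [u'] ∈ F x := by
  simp [forestMulti, H]

theorem forestPos_snoc_of_mem {v₀ : V} {F : Index P V → Set (List V)} {h h' : List V} {u u' : V}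
    {x : Index P V} (H : G.forestPos v₀ F (h ++ [u]) = (x, h', u))
    (hu' : h' ++ [u] ++ [u'] ∈ F x) :
    G.forestPos v₀ F (h ++ [u] ++ [u']) = (x, h' ++ [u], u') := by
  rw [forestPos_snoc, H]
  exact if_pos hu'

theorem forestPos_snoc_of_notMem {v₀ : V} {F : Index P V → Set (List V)} {h h' : List V}
    {u u' : V} {x : Index P V} (H : G.forestPos v₀ F (h ++ [u]) = (x, h', u))
    (hu' : h' ++ [u] ++ [u'] ∉ F x) :
    G.forestPos v₀ F (h ++ [u] ++ [u']) =
      ((some (G.owner u), u', x.2.2 ∪ G.visit (h' ++ [u] ++ [u'])), [], u') := by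
  rw [forestPos_snoc, H]
  exact if_neg hu'

/-- The position after `h ++ [u]`, whose last part `h' ++ [u]` is in the current tree. -/
structure IsForestPos (G : ReachGame P V) (v₀ : V) (F : Index P V → Set (List V)) (h : List V)
    (u : V) (x : Index P V) (g h' : List V) : Prop where
  pos_eq : G.forestPos v₀ F (h ++ [u]) = (x, h', u)
  eq_append : h = g ++ h'
  mem_indices : x ∈ G.Indices v₀
  mem_tree : h' ++ [u] ∈ F x
  root_mem : g ++ [x.2.1] ∈ G.Hist v₀
  pos_root : G.forestPos v₀ F (g ++ [x.2.1]) = (x, [], x.2.1)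
  visit_root : G.visit (g ++ [x.2.1]) = x.2.2
  main_or_out : (g = [] ∧ x = G.rootIndex v₀) ∨
    (x ∈ G.Out v₀ F ∧ h ++ [u] ∉ F (G.rootIndex v₀))

theorem IsForestPos.visit_eq {v₀ : V} {F : Index P V → Set (List V)} {h : List V}
    {u : V} {x : Index P V} {g h' l : List V} (hp : G.IsForestPos v₀ F h u x g h')
    (hl : h' ++ l ∈ G.Hist x.2.1) : G.visit (h ++ l) = x.2.2 ∪ G.visit (h' ++ l) := by
  rw [hp.eq_append, List.append_assoc, visit_append_of_mem_hist hl, hp.visit_root]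

/-- The invariant to carry is that the index remembers the visits before its tree was entered. So
the third component computed at a jump is the `visit` of the whole history, and the new index
belongs to `Indices`. A history that has left the main tree never re-enters it, which keeps later
indices in `Out`. -/
theorem IsForest.exists_isForestPos {v₀ : V} {F : Index P V → Set (List V)}
    (hF : G.IsForest v₀ F) (h : List V) (u : V) (hu : h ++ [u] ∈ G.Hist v₀) :
    ∃ x g h', G.IsForestPos v₀ F h u x g h' := by
  have hr : G.rootIndex v₀ ∈ G.Indices v₀ := Or.inl rfl
  refine hist_induction (p := fun h u => ∃ x g h', G.IsForestPos v₀ F h u x g h') ?_ ?_ h u hu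
  · refine ⟨G.rootIndex v₀, [], [], rfl, rfl, hr, (hF _ hr).1.2.1, singleton_mem_hist.2 rfl, rfl,
      ?_, Or.inl ⟨rfl, rfl⟩⟩
    ext i
    simp [rootIndex, visit]
  · rintro h u u' hu he ⟨x, g, h', hp⟩
    have hu' := snoc_mem_hist.2 ⟨hu, he⟩
    have hmain : h ++ [u] ∉ F (G.rootIndex v₀) → h ++ [u] ++ [u'] ∉ F (G.rootIndex v₀) :=
      fun H H' => H ((hF _ hr).1.2.2 _ _ (by simp) H')
    by_cases hm : h' ++ [u] ++ [u'] ∈ F x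
    · exact ⟨x, g, h' ++ [u], forestPos_snoc_of_mem hp.pos_eq hm, by simp [hp.eq_append],
        hp.mem_indices, hm, hp.root_mem, hp.pos_root, hp.visit_root,
        hp.main_or_out.imp_right fun H => ⟨H.1, hmain H.2⟩⟩
    · have hpos := forestPos_snoc_of_notMem hp.pos_eq hm
      have hh' := snoc_mem_hist.2 ⟨(hF x hp.mem_indices).1.1 hp.mem_tree, he⟩
      rw [List.append_assoc] at hh'
      have hvis := hp.visit_eq hh'
      rw [← List.append_assoc, ← List.append_assoc] at hvis
      rw [← hvis] at hpos
      have hi := mem_indices_of_hist hu'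
      have hnot : h ++ [u] ++ [u'] ∉ F (G.rootIndex v₀) := by
        rcases hp.main_or_out with ⟨rfl, rfl⟩ | H
        · rw [hp.eq_append]; exact hm
        · exact hmain H.2
      exact ⟨_, h ++ [u], [], hpos, by simp, hi, (hF _ hi).1.2.1, hu', hpos, rfl,
        Or.inr ⟨⟨_, h, u, u', hu', hnot, rfl, rfl⟩, hnot⟩⟩

theorem IsForest.isMulti {v₀ : V} {F : Index P V → Set (List V)} (hF : G.IsForest v₀ F) :
    G.IsMulti v₀ (G.forestMulti v₀ F) := by
  intro i h u hu
  obtain ⟨x, g, h', hp⟩ := hF.exists_isForestPos h u (snoc_mem_histOf.1 hu).1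
  obtain ⟨ht, hl⟩ := hF x hp.mem_indices
  constructor
  · obtain ⟨u', hu'⟩ := hl _ hp.mem_tree
    exact ⟨u', (mem_forestMulti hp.pos_eq).2 hu'⟩
  · intro u' hu'
    exact (snoc_mem_hist.1 (ht.1 ((mem_forestMulti hp.pos_eq).1 hu'))).2

/-- Allowed moves never leave the current tree. The induction carries the forest position along with
membership, since the position determines which moves are allowed next. -/
theorem IsForest.multiHist_eq {v₀ v : V} {F : Index P V → Set (List V)} (hF : G.IsForest v₀ F)
    {h h' : List V} {x : Index P V} (hv : h ++ [v] ∈ G.Hist v₀)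
    (hpos : G.forestPos v₀ F (h ++ [v]) = (x, h', v)) (hm : h' ++ [v] ∈ F x)
    (hx : x ∈ G.Indices v₀) :
    G.multiHist (restrict (G.forestMulti v₀ F) h) v = G.subtree (F x) h' v := by
  have hM := hF.isMulti.restrict hv
  have key := hist_induction (G := G) (v := v) (p := fun k u =>
    (k ++ [u] ∈ G.multiHist (restrict (G.forestMulti v₀ F) h) v ↔ h' ++ k ++ [u] ∈ F x) ∧
    (h' ++ k ++ [u] ∈ F x → G.forestPos v₀ F (h ++ k ++ [u]) = (x, h' ++ k, u)))
    (by
      simp only [List.append_nil]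
      exact ⟨iff_of_true (singleton_mem_multiHist hM) hm, fun _ => hpos⟩)
    (by
      rintro k u u' hk he ⟨ih1, ih2⟩
      simp only [← List.append_assoc]
      have hpre : h' ++ k ++ [u] ++ [u'] ∈ F x → h' ++ k ++ [u] ∈ F x :=
        (hF x hx).1.2.2 _ _ (by simp)
      refine ⟨?_, fun H => forestPos_snoc_of_mem (ih2 (hpre H)) H⟩
      rw [snoc_mem_multiHist hM, ih1]
      have hr : restrict (G.forestMulti v₀ F) h (G.owner u) (k ++ [u]) =
        G.forestMulti v₀ F (G.owner u) (h ++ k ++ [u]) := by simp [restrict]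
      rw [hr]
      constructor
      · rintro ⟨h1, h2⟩
        exact (mem_forestMulti (ih2 h1)).1 h2
      · intro H
        exact ⟨hpre H, (mem_forestMulti (ih2 (hpre H))).2 H⟩)
  ext l
  constructor
  · intro hl
    have hl' := multiHist_subset_hist hl
    obtain ⟨k, u, rfl⟩ := exists_snoc_of_mem_hist hl'
    exact ⟨hl', by rw [← List.append_assoc]; exact (key k u hl').1.1 hl⟩
  · rintro ⟨hl', hl⟩
    obtain ⟨k, u, rfl⟩ := exists_snoc_of_mem_hist hl'
    rw [← List.append_assoc] at hl
    exact (key k u hl').1.2 hl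

theorem IsForest.multiHist_root_eq {v₀ : V} {F : Index P V → Set (List V)} (hF : G.IsForest v₀ F)
    {g : List V} {x : Index P V} (hx : x ∈ G.Indices v₀) (hg : g ++ [x.2.1] ∈ G.Hist v₀)
    (hpos : G.forestPos v₀ F (g ++ [x.2.1]) = (x, [], x.2.1)) :
    G.multiHist (restrict (G.forestMulti v₀ F) g) x.2.1 = F x := by
  rw [hF.multiHist_eq hg hpos (hF x hx).1.2.1 hx]
  ext l
  exact ⟨fun h => h.2, fun h => ⟨(hF x hx).1.1 h, h⟩⟩

theorem IsForest.multiHist_main_eq {v₀ : V} {F : Index P V → Set (List V)}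
    (hF : G.IsForest v₀ F) : G.multiHist (G.forestMulti v₀ F) v₀ = F (G.rootIndex v₀) :=
  hF.multiHist_root_eq (g := []) (x := G.rootIndex v₀) (Or.inl rfl) (singleton_mem_hist.2 rfl) rfl

/-- If `v₁` is a child in the current tree, then so is `ρ 1`, and the node has two children:
internal resistance equates the gains. Otherwise the play after `v₁` is a branch of the tree entered
by the jump, and external resistance applies. -/
theorem IsGoodForest.noOneShotDeviation {v₀ : V} {F : Index P V → Set (List V)}
    (hF : G.IsGoodForest v₀ F) : G.NoOneShotDeviation v₀ (G.forestMulti v₀ F) := by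
  obtain ⟨hF, hgood⟩ := hF
  have hM := hF.isMulti
  intro h v v₁ hv hvis he ρ₁ hρ₁ hgain ρ hρ hne
  obtain ⟨x, g, h', hp⟩ := hF.exists_isForestPos h v hv
  have hMh := hM.restrict hv
  have hbr : G.branches v (G.subtree (F x) h' v) =
      G.multiOutcome (restrict (G.forestMulti v₀ F) h) v := by
    rw [← hF.multiHist_eq hv hp.pos_eq hp.mem_tree hp.mem_indices, branches_multiHist hMh]
  have ht := (hF x hp.mem_indices).1
  have hvis' := hp.visit_eq (ht.1 hp.mem_tree)
  rw [hvis'] at hvis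
  obtain ⟨hint, hext⟩ := hgood x hp.mem_indices
  by_cases hm : h' ++ [v] ++ [v₁] ∈ F x
  · have hcat : cat [v] ρ₁ ∈ G.multiOutcome (restrict (G.forestMulti v₀ F) h) v := by
      refine cat_singleton_mem_multiOutcome (v₁ := v₁) hMh ?_ (by rwa [restrict_restrict])
      exact (mem_forestMulti hp.pos_eq).2 hm
    have hρ' := (mem_multiOutcome hMh).1 hρ
    have hm' : h' ++ [v] ++ [ρ 1] ∈ F x := by
      have := hρ'.2 0
      rw [pre_zero, hρ'.1] at this
      exact (mem_forestMulti hp.pos_eq).1 this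
    have heq := hint (G.owner v) (fun H => hvis (Or.inl H)) h' v hp.mem_tree rfl
      ⟨v₁, hm, ρ 1, hm', hne.symm⟩ _ (hbr ▸ hcat) ρ (hbr ▸ hρ)
    rw [gain_cat.2 (Or.inr (gain_cat.2 (Or.inr hgain)))] at heq
    refine (gain_cat.1 heq.symm).resolve_left fun H => hvis (Or.inr ?_)
    rw [visit_append]
    exact Or.inl H
  · refine hext h' v _ hp.mem_tree rfl hvis v₁ he hm ⟨ρ₁, ?_, hgain⟩ ρ (hbr ▸ hρ)
    have hv₁ := snoc_mem_hist.2 ⟨hv, he⟩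
    have hpos := forestPos_snoc_of_notMem hp.pos_eq hm
    have hh' := snoc_mem_hist.2 ⟨ht.1 hp.mem_tree, he⟩
    rw [List.append_assoc] at hh'
    have hvis₁ := hp.visit_eq hh'
    rw [← List.append_assoc, ← List.append_assoc] at hvis₁
    rw [← hvis₁] at hpos ⊢
    rw [← hF.multiHist_root_eq (mem_indices_of_hist hv₁) hv₁ hpos,
      branches_multiHist (hM.restrict hv₁)]
    exact hρ₁

theorem IsForestPos.mem_out {v₀ : V} {F : Index P V → Set (List V)} {h : List V}
    {u : V} {x : Index P V} {g h' : List V} (hp : G.IsForestPos v₀ F h u x g h')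
    (hd : h ++ [u] ∉ F (G.rootIndex v₀)) : x ∈ G.Out v₀ F := by
  rcases hp.main_or_out with ⟨hg, hx⟩ | H
  · refine (hd ?_).elim
    rw [hp.eq_append, hg, ← hx]
    exact hp.mem_tree
  · exact H.1

theorem penal_restrict_le [Fintype V] (Θ : P → List V → Set V) (i : P) (h : List V)
    (ρ : ℕ → V) : G.penal (restrict Θ h) i ρ ≤ G.penal Θ i (cat h ρ) := by
  unfold penal
  exact iSup_le fun k => le_iSup_of_le (h.length + k)
    (Nat.cast_le.2 (penalPre_restrict_le Θ i h ρ k))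

/-- Prefixing `ρ` with the part `h'` already travelled in the current tree gives a full branch of
that tree, and this can only increase the penalty. -/
theorem IsForestPos.penal_le [Fintype V] {v₀ : V} {F : Index P V → Set (List V)}
    (hF : G.IsForest v₀ F) {h : List V} {v : V} {x : Index P V} {g h' : List V}
    (hp : G.IsForestPos v₀ F h v x g h') {ρ : ℕ → V}
    (hρ : ρ ∈ G.multiOutcome (restrict (G.forestMulti v₀ F) h) v) (i : P) :
    G.penal (restrict (G.forestMulti v₀ F) h) i ρ ≤ G.treePenalty x.2.1 (F x) i := by
  have hMg := hF.isMulti.restrict hp.root_mem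
  have htree := hF.multiHist_root_eq hp.mem_indices hp.root_mem hp.pos_root
  rw [hp.eq_append, ← restrict_restrict] at hρ ⊢
  have hcat := cat_mem_multiOutcome hMg (htree.symm ▸ hp.mem_tree) hρ
  rw [← htree, treePenalty_multiHist hMg]
  exact (penal_restrict_le _ i h' ρ).trans (le_iSup₂_of_le _ hcat le_rfl)

theorem IsForest.retaliationPenalty_le [Fintype V] {v₀ : V} {F : Index P V → Set (List V)}
    (hF : G.IsForest v₀ F) (i : P) :
    G.retaliationPenalty (G.forestMulti v₀ F) v₀ i ≤ G.forestRetaliationPenalty v₀ F i := by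
  unfold retaliationPenalty forestRetaliationPenalty
  refine iSup_le fun h => iSup_le fun v => iSup_le fun H => iSup₂_le fun ρ hρ => ?_
  obtain ⟨x, g, h', hp⟩ := hF.exists_isForestPos h v (snoc_mem_histOf.1 H.1).1
  have hout := hp.mem_out (hF.multiHist_main_eq ▸ H.2)
  exact (hp.penal_le hF hρ i).trans (le_iSup₂_of_le x hout le_rfl)

theorem IsGoodForest.exists_isPermissiveSPE [Fintype V] {v₀ : V} {F : Index P V → Set (List V)}
    (hF : G.IsGoodForest v₀ F) :
    ∃ Θ, G.IsPermissiveSPE v₀ Θ ∧ F (G.rootIndex v₀) = G.multiHist Θ v₀ ∧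
      ∀ i, G.retaliationPenalty Θ v₀ i ≤ G.forestRetaliationPenalty v₀ F i :=
  ⟨_, hF.noOneShotDeviation.isPermissiveSPE hF.1.isMulti, hF.1.multiHist_main_eq.symm,
    hF.1.retaliationPenalty_le⟩

/-! ### The equivalence -/

theorem forestMainPenalty_eq [Fintype V] {v₀ : V} {F : Index P V → Set (List V)}
    {Θ : P → List V → Set V} (hΘ : G.IsMulti v₀ Θ)
    (h : F (G.rootIndex v₀) = G.multiHist Θ v₀) (i : P) :
    G.forestMainPenalty v₀ F i = G.mainPenalty Θ v₀ i := by
  rw [forestMainPenalty, h, treePenalty_multiHist hΘ, mainPenalty]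

theorem stronglyWinning_iff {v₀ : V} {T : Set (List V)} {Θ : P → List V → Set V} {W : Set P}
    (hΘ : G.IsMulti v₀ Θ) (h : T = G.multiHist Θ v₀) :
    G.StronglyWinning v₀ Θ W ↔ ∀ ρ ∈ G.branches v₀ T, ∀ i ∈ W, G.gain i ρ = 1 := by
  rw [h, branches_multiHist hΘ]
  constructor
  · rintro H _ ⟨σ, hσ, rfl⟩
    exact H σ hσ
  · exact fun H σ hσ => H _ hσ.outcome_mem

theorem weaklyWinning_iff {v₀ : V} {T : Set (List V)} {Θ : P → List V → Set V} {W : Set P}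
    (hΘ : G.IsMulti v₀ Θ) (h : T = G.multiHist Θ v₀) :
    G.WeaklyWinning v₀ Θ W ↔ ∃ ρ ∈ G.branches v₀ T, ∀ i ∈ W, G.gain i ρ = 1 := by
  rw [h, branches_multiHist hΘ]
  constructor
  · rintro ⟨σ, hσ, H⟩
    exact ⟨_, hσ.outcome_mem, H⟩
  · rintro ⟨_, ⟨σ, hσ, rfl⟩, H⟩
    exact ⟨σ, hσ, H⟩

end ReachGame

open ReachGame in
theorem mainTheorem3 {P V : Type*} [Fintype P] [Fintype V] (G : ReachGame P V) (v₀ : V)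
    (m r : P → ℕ∞) (Tstar : Set (List V)) (hT : G.IsTree v₀ Tstar) (W : Set P) :
    ((∃ Θ : P → List V → Set V, G.IsPermissiveSPE v₀ Θ ∧
        G.multiHist Θ v₀ = Tstar ∧
        G.StronglyWinning v₀ Θ W ∧
        ∀ i, G.mainPenalty Θ v₀ i ≤ m i ∧ G.retaliationPenalty Θ v₀ i ≤ r i) ↔
      (∃ F : ReachGame.Index P V → Set (List V), G.IsGoodForest v₀ F ∧
        F (G.rootIndex v₀) = Tstar ∧
        (∀ ρ ∈ G.branches v₀ (F (G.rootIndex v₀)), ∀ i ∈ W, G.gain i ρ = 1) ∧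
        ∀ i, G.forestMainPenalty v₀ F i ≤ m i ∧ G.forestRetaliationPenalty v₀ F i ≤ r i)) ∧
    ((∃ Θ : P → List V → Set V, G.IsPermissiveSPE v₀ Θ ∧
        G.multiHist Θ v₀ = Tstar ∧
        G.WeaklyWinning v₀ Θ W ∧
        ∀ i, G.mainPenalty Θ v₀ i ≤ m i ∧ G.retaliationPenalty Θ v₀ i ≤ r i) ↔
      (∃ F : ReachGame.Index P V → Set (List V), G.IsGoodForest v₀ F ∧
        F (G.rootIndex v₀) = Tstar ∧
        (∃ ρ ∈ G.branches v₀ (F (G.rootIndex v₀)), ∀ i ∈ W, G.gain i ρ = 1) ∧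
        ∀ i, G.forestMainPenalty v₀ F i ≤ m i ∧ G.forestRetaliationPenalty v₀ F i ≤ r i)) := by
  constructor
  all_goals constructor
  · rintro ⟨Θ, hΘ, hh, hW, hp⟩
    obtain ⟨F, hF, hroot, hr⟩ := hΘ.exists_isGoodForest
    exact ⟨F, hF, hroot.trans hh, (stronglyWinning_iff hΘ.1 hroot).1 hW, fun i =>
      ⟨(forestMainPenalty_eq hΘ.1 hroot i).trans_le (hp i).1, (hr i).trans (hp i).2⟩⟩
  · rintro ⟨F, hF, hh, hW, hp⟩
    obtain ⟨Θ, hΘ, hroot, hr⟩ := hF.exists_isPermissiveSPE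
    exact ⟨Θ, hΘ, hroot.symm.trans hh, (stronglyWinning_iff hΘ.1 hroot).2 hW, fun i =>
      ⟨(forestMainPenalty_eq hΘ.1 hroot i).symm.trans_le (hp i).1, (hr i).trans (hp i).2⟩⟩
  · rintro ⟨Θ, hΘ, hh, hW, hp⟩
    obtain ⟨F, hF, hroot, hr⟩ := hΘ.exists_isGoodForest
    exact ⟨F, hF, hroot.trans hh, (weaklyWinning_iff hΘ.1 hroot).1 hW, fun i =>
      ⟨(forestMainPenalty_eq hΘ.1 hroot i).trans_le (hp i).1, (hr i).trans (hp i).2⟩⟩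
  · rintro ⟨F, hF, hh, hW, hp⟩
    obtain ⟨Θ, hΘ, hroot, hr⟩ := hF.exists_isPermissiveSPE
    exact ⟨Θ, hΘ, hroot.symm.trans hh, (weaklyWinning_iff hΘ.1 hroot).2 hW, fun i =>
      ⟨(forestMainPenalty_eq hΘ.1 hroot i).symm.trans_le (hp i).1, (hr i).trans (hp i).2⟩⟩
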